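/- Let $(X,\mathcal O_X)$ be a ringed space (for example a connected complex manifold with its sheaf of holomorphic functions) and let $\mathcal U=\{U_a\}_{a\in I}$ be an open cover of $X$ (for example a Stein cover); write $U_{\alpha_0\dots\alpha_p}=U_{\alpha_0}\cap\dots\cap U_{\alpha_p}$. For an open set $U$ let $\mathrm{Free}(U)$ be the dg-category of bounded cochain complexes of finite free $\mathcal O_U$-modules, with $\partial f=f\circ d_C+(-1)^{n+1}d_D\circ f$ for $f\in\mathrm{Hom}^n(C,D)$. Let $\mathcal N^{\mathrm{dg}}\mathrm{Free}(U)$ be its dg-nerve: an $n$-simplex consists of complexes $x_0,\dots,x_n$ and, for all $I=\{i_0<\dots<i_k\}\subseteq[n]$ with $k\ge1$, of elements $f_I\in\mathrm{Hom}^{1-k}(x_{i_k},x_{i_0})$ such that $$\partial f_I=\sum_{j=1}^{k-1}(-1)^{j-1}f_{I\setminus\{i_j\}}+\sum_{j=1}^{k-1}(-1)^{k(j-1)+1}f_{\{i_0<\dots<i_j\}}\circ f_{\{i_j<\dots<i_k\}}.$$ Let $\mathcal Twist(U)$ be the core (largest Kan subcomplex) of $\mathcal N^{\mathrm{dg}}\mathrm{Free}(U)$,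 let $Y$ be the cosimplicial simplicial set $Y^p=\mathcal Twist(\check{\mathcal N}\mathcal U_p)=\prod_{\alpha_0,\dots,\alpha_p\in I}\mathcal Twist(U_{\alpha_0\dots\alpha_p})$, with cosimplicial structure given by restriction, and let $\mathrm{Tot}\,Y$ be its totalisation, whose $n$-simplices are the morphisms $\Delta[\star]\times\Delta[n]\to Y$ of cosimplicial simplicial sets. A vertex of $\mathrm{Tot}\,Y$ determines complexes $E_a^\bullet\in\mathrm{Free}(U_a)$ and morphisms $\varphi_{\alpha_0\dots\alpha_p}\in\mathrm{Hom}^{1-p}(E_{\alpha_p},E_{\alpha_0})$ over $U_{\alpha_0\dots\alpha_p}$, namely the labels of the nondegenerate top-dimensional simplices of the $\Delta[p]$, where $\varphi_a$ is the differential of $E_a^\bullet$. For Čech cochains $u$ of total degree $s$ (so that $u_{\alpha_0\dots\alpha_p}$ is a morphism of degree $s-p$ from the object at $\alpha_p$ to the object at $\alpha_0$) and $w$, put $$(\hat\delta u)_{\alpha_0\dots\alpha_p}=\sum_{j=1}^{p-1}(-1)^ju_{\alpha_0\dots\widehat{\alpha_j}\dots\alpha_p},\qquad(u\cdot w)_{\alpha_0\dots\alpha_p}=\sum_{j=0}^{p}(-1)^{(s-j)(p-j)}u_{\alpha_0\dots\alpha_j}\circ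 w_{\alpha_j\dots\alpha_p}.$$ **Theorem.** Let $E=(E^\bullet,\varphi)$ and $F=(F^\bullet,\psi)$ be vertices of $\mathrm{Tot}\,Y$, and let $\lambda$ be a $1$-simplex of $\mathrm{Tot}\,Y$ from $E$ to $F$. Then $(E^\bullet,\varphi)$ and $(F^\bullet,\psi)$ are twisting cochains, i.e. $\hat\delta\varphi+\varphi\cdot\varphi=0$ and $\varphi_{aa}=\mathrm{id}$ for all $a\in I$, and likewise for $\psi$. Moreover the morphisms $$\lambda_{\alpha_0\dots\alpha_p}=\sum_{m=0}^{p}(-1)^mf_{\Delta_m}\in\mathrm{Hom}^{-p}(F_{\alpha_p},E_{\alpha_0})$$ over $U_{\alpha_0\dots\alpha_p}$, where $f_{\Delta_m}$ is the label that $\lambda$ gives to the nondegenerate $(p+1)$-simplex $\Delta_m$ of $\Delta[p]\times\Delta[1]$ with vertices $(0,0),\dots,(m,0),(m,1),\dots,(p,1)$, form a weak equivalence of twisting cochains $(F^\bullet,\psi)\to(E^\bullet,\varphi)$ in the sense of Wei: this cochain of total degree $0$ is closed, that is, $\hat\delta\lambda+\varphi\cdot\lambda-\lambda\cdot\psi=0$,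 and for every $a\in I$ the chain map $\lambda_a\colon F_a^\bullet\to E_a^\bullet$ is a quasi-isomorphism of complexes of $\mathcal O_{U_a}$-modules. -/

import Mathlib

open CategoryTheory Opposite TopologicalSpace Simplicial
open scoped MonoidalCategory

universe u v

namespace TwistCech

/-! ### Bounded complexes of finite free modules

A bounded graded finite free module over `R` is given by its rank function `r : ℤ →₀ ℕ`: it is
`R ^ (r k)` in degree `k`, with standard basis `e_(k,0), …, e_(k, r k - 1)`.
The morphisms of `𝒪_U`-modules `𝒪_U ^ m ⟶ 𝒪_U ^ n` are the `n × m` matrices with entries in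
`R = Γ(U, 𝒪_U)`. Morphisms between graded modules are written here as matrices over one index type
`(k, a)`, extended by zero outside of the basis elements that really occur (see `IsHom`). -/

/-- Indices `⟨k, a⟩` of basis elements: the `a`-th basis element in degree `k`. -/
abbrev Idx : Type := (_ : ℤ) × ℕ

/-- Matrices indexed by all possible basis elements. -/
abbrev GrMat (R : Type u) : Type u := Matrix Idx Idx R

/-- The basis of the graded free module `⨁ₖ R ^ (r k)`. -/
def basis (r : ℤ →₀ ℕ) : Finset Idx := r.support.sigma fun k => Finset.range (r k)

section Algebra

variable {R : Type u} [CommRing R]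

/-- `M` is a morphism of degree `n` from the graded free module of rank `r` to the one of rank
`s`, i.e. an element of `∏ₖ Hom(R ^ (r k), R ^ (s (k + n)))`: the entry in row `i`, column `j` is
the coefficient of the target basis element `i` in the image of the source basis element `j`. -/
def IsHom (r s : ℤ →₀ ℕ) (n : ℤ) (M : GrMat R) : Prop :=
  ∀ i j, M i j ≠ 0 → i ∈ basis s ∧ j ∈ basis r ∧ i.1 = j.1 + n

/-- The composition `M ∘ N`, where `r` is the rank of the module in the middle. -/
def comp (r : ℤ →₀ ℕ) (M N : GrMat R) : GrMat R := fun i j => ∑ k ∈ basis r, M i k * N k j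

open Classical in
/-- The identity of the graded free module of rank `r`. -/
noncomputable def idMat (R : Type u) [CommRing R] (r : ℤ →₀ ℕ) : GrMat R :=
  fun i j => if i = j ∧ i ∈ basis r then 1 else 0

/-- The component `R ^ (r k) ⟶ R ^ (s l)` of a morphism. -/
def block (r s : ℤ →₀ ℕ) (k l : ℤ) (M : GrMat R) : Matrix (Fin (s l)) (Fin (r k)) R :=
  fun b a => M ⟨l, b⟩ ⟨k, a⟩

variable (R) in
/-- A bounded complex of finite free modules: the objects of the dg-category `Free`. -/
@[ext]
structure FreeComplex where
  /-- the ranks -/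
  rk : ℤ →₀ ℕ
  /-- the differential -/
  d : GrMat R
  d_isHom : IsHom rk rk 1 d
  d_comp_d : comp rk d d = 0

/-- The differential of the complex `Hom(C, D)` on an element `f` of degree `n`:
`∂ f = f ∘ d_C + (-1) ^ (n + 1) d_D ∘ f`. -/
def homDiff (C D : FreeComplex R) (n : ℤ) (f : GrMat R) : GrMat R :=
  comp C.rk f C.d + (n + 1).negOnePow • comp D.rk D.d f

theorem mem_basis {r : ℤ →₀ ℕ} {i : Idx} : i ∈ basis r ↔ i.2 < r i.1 := by
  simp only [basis, Finset.mem_sigma, Finsupp.mem_support_iff, Finset.mem_range]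
  omega

section BaseChange

variable {S : Type u} [CommRing S] (φ : R →+* S)

theorem IsHom.map {r s : ℤ →₀ ℕ} {n : ℤ} {M : GrMat R} (h : IsHom r s n M) :
    IsHom r s n (M.map φ) := by
  intro i j hij
  refine h i j fun h0 => hij ?_
  simp [Matrix.map_apply, h0]

theorem comp_map (r : ℤ →₀ ℕ) (M N : GrMat R) :
    (comp r M N).map φ = comp r (M.map φ) (N.map φ) := by
  ext i j
  simp [comp, Matrix.map_apply, map_sum, map_mul]

theorem idMat_map (r : ℤ →₀ ℕ) : (idMat R r).map φ = idMat S r := by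
  ext i j
  simp only [idMat, Matrix.map_apply]
  split_ifs <;> simp

theorem negOnePow_smul_map (n : ℤ) (M : GrMat R) :
    (n.negOnePow • M).map φ = n.negOnePow • M.map φ := by
  ext i j
  rcases Int.even_or_odd n with h | h
  · simp [Int.negOnePow_even n h]
  · simp [Int.negOnePow_odd n h, Matrix.map_apply]

theorem sum_map {κ : Type*} (s : Finset κ) (f : κ → GrMat R) :
    (∑ k ∈ s, f k).map φ = ∑ k ∈ s, (f k).map φ :=
  map_sum (φ.toAddMonoidHom.mapMatrix (m := Idx) (n := Idx)) f s

theorem add_map (M N : GrMat R) : (M + N).map φ = M.map φ + N.map φ := by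
  ext i j
  simp [Matrix.map_apply]

/-- Base change of a complex along a ring morphism (in particular restriction to a smaller open
subset, and passage to a stalk). -/
def FreeComplex.map (C : FreeComplex R) : FreeComplex S where
  rk := C.rk
  d := C.d.map φ
  d_isHom := C.d_isHom.map φ
  d_comp_d := by
    rw [← comp_map, C.d_comp_d]
    ext i j
    simp

theorem homDiff_map (C D : FreeComplex R) (n : ℤ) (f : GrMat R) :
    (homDiff C D n f).map φ = homDiff (C.map φ) (D.map φ) n (f.map φ) := by
  simp [homDiff, add_map, negOnePow_smul_map, comp_map, FreeComplex.map]

end BaseChange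

theorem block_mul_block (C : FreeComplex R) (k : ℤ) :
    block C.rk C.rk (k + 1) (k + 1 + 1) C.d * block C.rk C.rk k (k + 1) C.d = 0 := by
  ext b a
  have h := congrFun (congrFun C.d_comp_d ⟨k + 1 + 1, b⟩) ⟨k, a⟩
  simp only [comp, basis, Finset.sum_sigma] at h
  rw [Finset.sum_eq_single (k + 1)] at h
  · rw [Finset.sum_range] at h
    simpa [Matrix.mul_apply, block] using h
  · intro l _ hl
    refine Finset.sum_eq_zero fun c _ => ?_
    by_contra hne
    exact hl (C.d_isHom ⟨l, c⟩ ⟨k, a⟩ (right_ne_zero_of_mul hne)).2.2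
  · intro hk
    have : C.rk (k + 1) = 0 := by simpa using hk
    simp [this]

/-- The complex of `R`-modules with terms `R ^ (rk k)`. -/
noncomputable def FreeComplex.toCochainComplex (C : FreeComplex R) :
    CochainComplex (ModuleCat.{u} R) ℤ :=
  CochainComplex.of (fun k => ModuleCat.of R (Fin (C.rk k) → R))
    (fun k => ModuleCat.ofHom (Matrix.toLin' (block C.rk C.rk k (k + 1) C.d)))
    (fun k => by
      rw [← ModuleCat.ofHom_comp, ← Matrix.toLin'_mul, block_mul_block]
      simp)

/-- `f` is a quasi-isomorphism of complexes of modules from `C` to `D`. -/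
def IsQuasiIso (C D : FreeComplex R) (f : GrMat R) : Prop :=
  ∃ g : C.toCochainComplex ⟶ D.toCochainComplex,
    (∀ k : ℤ, g.f k = ModuleCat.ofHom (Matrix.toLin' (block C.rk D.rk k k f))) ∧ QuasiIso g

end Algebra

/-! ### The dg-nerve -/

/-- The inclusion of the front face `{0 < ⋯ < j}` of `{0 < ⋯ < n}`. -/
def front {n : ℕ} (j : Fin (n + 1)) : ⦋(j : ℕ)⦌ ⟶ ⦋n⦌ :=
  SimplexCategory.mkHom
    { toFun := fun i => ⟨i, by omega⟩
      monotone' := fun _ _ h => h }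

/-- The inclusion of the back face `{j < ⋯ < n}` of `{0 < ⋯ < n}`. -/
def back {n : ℕ} (j : Fin (n + 1)) : ⦋n - (j : ℕ)⦌ ⟶ ⦋n⦌ :=
  SimplexCategory.mkHom
    { toFun := fun i => ⟨i + j, by omega⟩
      monotone' := fun _ _ h => Nat.add_le_add_right h _ }

/-- The `n`-simplices of the dg-nerve of the dg-category of bounded complexes of finite free
modules. Every simplex `σ : [k] ⟶ [n]` of `Δ[n]` with `k ≥ 1` is labelled by a morphism of degree
`1 - k` from the object at the last vertex of `σ` to the object at its first vertex. The labels of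
degenerate simplices are the trivial ones (identities if `k = 1`, and `0` if `k ≥ 2`), so that the
data are the labels of the nonempty faces `I ⊆ [n]`. For degenerate `σ`, the equation `lab_eq`
holds automatically. Vertices are labelled by the differentials of their objects. -/
@[ext]
structure DGSimplex (R : Type u) [CommRing R] (n : SimplexCategory) where
  /-- the objects at the vertices -/
  obj : Fin (n.len + 1) → FreeComplex R
  /-- the labels -/
  lab : ∀ k : ℕ, (⦋k⦌ ⟶ n) → GrMat R
  lab_zero : ∀ σ : ⦋0⦌ ⟶ n, lab 0 σ = (obj (σ.toOrderHom 0)).d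
  lab_isHom : ∀ (k : ℕ) (σ : ⦋k⦌ ⟶ n),
    IsHom (obj (σ.toOrderHom (Fin.last k))).rk (obj (σ.toOrderHom 0)).rk (1 - (k : ℤ)) (lab k σ)
  lab_id : ∀ σ : ⦋1⦌ ⟶ n, σ.toOrderHom 0 = σ.toOrderHom 1 →
    lab 1 σ = idMat R (obj (σ.toOrderHom 0)).rk
  lab_degenerate : ∀ (k : ℕ) (σ : ⦋k + 2⦌ ⟶ n), ¬ Function.Injective σ.toOrderHom →
    lab (k + 2) σ = 0
  /-- With `K = k + 1` and `J = j + 1`, the equation reads `∂ f_σ =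
  ∑_{0 < J < K} (-1) ^ (J - 1) f_(σ without its vertex J) +
  ∑_{0 < J < K} (-1) ^ (K (J - 1) + 1) f_(front face 0, …, J) ∘ f_(back face J, …, K)`. -/
  lab_eq : ∀ (k : ℕ) (σ : ⦋k + 1⦌ ⟶ n),
    homDiff (obj (σ.toOrderHom (Fin.last (k + 1)))) (obj (σ.toOrderHom 0)) (-(k : ℤ))
        (lab (k + 1) σ) =
      ∑ j : Fin k, (j : ℤ).negOnePow • lab k (SimplexCategory.δ j.succ.castSucc ≫ σ) +
      ∑ j : Fin k, (((k : ℤ) + 1) * j + 1).negOnePow •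
        comp (obj (σ.toOrderHom j.succ.castSucc)).rk
          (lab _ (front j.succ.castSucc ≫ σ)) (lab _ (back j.succ.castSucc ≫ σ))

namespace DGSimplex

variable {R : Type u} [CommRing R]

/-- The action of a morphism `θ : [m] ⟶ [n]` on simplices: forget labels, or repeat vertices. -/
def pullback {m n : SimplexCategory} (θ : m ⟶ n) (s : DGSimplex R n) : DGSimplex R m where
  obj i := s.obj (θ.toOrderHom i)
  lab k σ := s.lab k (σ ≫ θ)
  lab_zero σ := s.lab_zero (σ ≫ θ)
  lab_isHom k σ := s.lab_isHom k (σ ≫ θ)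
  lab_id σ h := s.lab_id (σ ≫ θ) (congrArg θ.toOrderHom h)
  lab_degenerate k σ h := s.lab_degenerate k (σ ≫ θ) fun hinj =>
    h (Function.Injective.of_comp (f := θ.toOrderHom) hinj)
  lab_eq k σ := s.lab_eq k (σ ≫ θ)

/-- Base change of simplices along a ring morphism. -/
def map {S : Type u} [CommRing S] (φ : R →+* S) {n : SimplexCategory} (s : DGSimplex R n) :
    DGSimplex S n where
  obj i := (s.obj i).map φ
  lab k σ := (s.lab k σ).map φ
  lab_zero σ := by rw [s.lab_zero]; rfl
  lab_isHom k σ := (s.lab_isHom k σ).map φ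
  lab_id σ h := by rw [s.lab_id σ h, idMat_map]; rfl
  lab_degenerate k σ h := by
    rw [s.lab_degenerate k σ h]
    ext i j
    simp
  lab_eq k σ := by
    rw [← homDiff_map, s.lab_eq, add_map, sum_map, sum_map]
    simp only [negOnePow_smul_map, comp_map]
    rfl

end DGSimplex

/-- The dg-nerve of the dg-category of bounded complexes of finite free modules over `R`. -/
def dgNerve (R : Type u) [CommRing R] : SSet.{u} where
  obj n := DGSimplex R n.unop
  map θ := TypeCat.ofHom fun s => s.pullback θ.unop
  map_id n := ConcreteCategory.hom_ext _ _ fun s =>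
    DGSimplex.ext (x := s.pullback (𝟙 n.unop)) (y := s) rfl <| by
      funext k σ
      exact congrArg (s.lab k) (Category.comp_id σ)
  map_comp _ _ := ConcreteCategory.hom_ext _ _ fun _ => rfl

/-- The dg-nerve as a functor of the ring. -/
def dgNerveFunctor : CommRingCat.{u} ⥤ SSet.{u} where
  obj R := dgNerve R
  map φ :=
    { app := fun _ => TypeCat.ofHom fun s => DGSimplex.map φ.hom s
      naturality := fun _ _ _ => ConcreteCategory.hom_ext _ _ fun _ => rfl }
  map_id _ :=
    NatTrans.ext (funext fun _ => ConcreteCategory.hom_ext _ _ fun _ => rfl)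
  map_comp _ _ :=
    NatTrans.ext (funext fun _ => ConcreteCategory.hom_ext _ _ fun _ => rfl)

/-! ### The core of a quasi-category, and the simplicial presheaf of twisting cochains -/

/-- The core of a quasi-category `X`, i.e. its largest Kan subcomplex: it consists of the simplices
all of whose edges are invertible. (Edges `e` and `e'` are inverse to each other if there are
2-simplices exhibiting the identities as compositions of `e` and `e'`, in both orders.) -/
def core (X : SSet.{u}) : X.Subcomplex where
  obj n := {x | ∀ f : ⦋1⦌ ⟶ n.unop, Nonempty (SSet.Edge.mk' (X.map f.op x)).InvStruct}
  map θ x hx f := by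
    have h : X.map (f ≫ θ.unop).op x = X.map f.op (X.map θ x) := by
      rw [op_comp, Quiver.Hom.op_unop, X.map_comp]
      rfl
    exact h ▸ hx (f ≫ θ.unop)

/-- The core as a functor. -/
def coreFunctor : SSet.{u} ⥤ SSet.{u} where
  obj X := (core X : SSet.{u})
  map {X Y} g := SSet.Subcomplex.lift ((core X).ι ≫ g) (by
    rintro n _ ⟨x, rfl⟩ f
    obtain ⟨I⟩ := x.2 f
    exact ⟨(I.map g).ofEq (NatTrans.naturality_apply g f.op x.1)⟩)
  map_id _ := rfl
  map_comp _ _ := rfl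

variable (X : AlgebraicGeometry.RingedSpace.{u})

/-- The simplicial presheaf `U ↦` core of the dg-nerve of `Free(U)`. -/
noncomputable def twist : (Opens X)ᵒᵖ ⥤ SSet.{u} :=
  X.presheaf ⋙ dgNerveFunctor ⋙ coreFunctor

variable {X} in
/-- The ring of sections over `V`. -/
abbrev Sec (V : Opens X) : Type u := X.presheaf.obj (op V)

variable {X} {ι : Type v} (U : ι → Opens X)

/-- The intersection `U_{α₀ … αₚ}`. -/
def cechOpen {n : ℕ} (α : Fin (n + 1) → ι) : Opens X := ⨅ i, U (α i)

theorem cechOpen_le {p q : SimplexCategory} (θ : p ⟶ q) (β : Fin (q.len + 1) → ι) :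
    cechOpen U β ≤ cechOpen U (β ∘ θ.toOrderHom) :=
  le_iInf fun i => iInf_le (fun j => U (β j)) (θ.toOrderHom i)

/-- The evaluation of `twist` on the Čech nerve of `U`. The Čech nerve is in degree `p` the disjoint
union of all `U_{α₀ … αₚ}`, on which the value of `twist` is the product of the
`twist(U_{α₀ … αₚ})`; the cosimplicial structure is given by restriction of sections. -/
noncomputable def cechTwist : SimplexCategory ⥤ SSet.{max u v} where
  obj p :=
    { obj := fun n => ∀ α : Fin (p.len + 1) → ι, ((twist X).obj (op (cechOpen U α))).obj n
      map := fun f => TypeCat.ofHom fun s α => ((twist X).obj (op (cechOpen U α))).map f (s α)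
      map_id := fun _ => ConcreteCategory.hom_ext _ _ fun _ => funext fun α => by
        simp
      map_comp := fun _ _ => ConcreteCategory.hom_ext _ _ fun _ => funext fun α => by
        simp }
  map {p q} θ :=
    { app := fun n => TypeCat.ofHom fun s β =>
        ((twist X).map (homOfLE (cechOpen_le U θ β)).op).app n (s (β ∘ θ.toOrderHom))
      naturality := fun _ _ f => ConcreteCategory.hom_ext _ _ fun _ => funext fun β => by
        exact NatTrans.naturality_apply ((twist X).map (homOfLE (cechOpen_le U θ β)).op) f _ }
  map_id p := by
    refine NatTrans.ext (funext fun n => ConcreteCategory.hom_ext _ _ fun s => ?_)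
    funext β
    exact congrArg (fun (g : (twist X).obj (op (cechOpen U β)) ⟶ _) => g.app n (s β))
      ((twist X).map_id _)
  map_comp {p q r} θ η := by
    refine NatTrans.ext (funext fun n => ConcreteCategory.hom_ext _ _ fun s => ?_)
    funext β
    exact congrArg (fun (g : (twist X).obj (op (cechOpen U (β ∘ (θ ≫ η).toOrderHom))) ⟶ _) =>
      g.app n (s _)) ((twist X).map_comp (homOfLE (cechOpen_le U θ (β ∘ η.toOrderHom))).op
        (homOfLE (cechOpen_le U η β)).op)

/-! ### Totalisation -/

/-- The cosimplicial simplicial set `Δ[⋆]`. -/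
abbrev Simplices : SimplexCategory ⥤ SSet.{u} := SSet.stdSimplex

/-- The totalisation of a cosimplicial simplicial set `Y`: its `n`-simplices are the morphisms
of cosimplicial simplicial sets `Δ[⋆] × Δ[n] ⟶ Y`. -/
def Tot (Y : SimplexCategory ⥤ SSet.{u}) : SSet.{u} :=
  ((Simplices ⋙ Functor.const SimplexCategory) ⋙ MonoidalCategory.tensorLeft Simplices).op ⋙
    yoneda.obj Y

/-- The value of an `n`-simplex `e : Δ[⋆] × Δ[n] ⟶ Y` of the totalisation on the `m`-simplex
`(a, b)` of `Δ[p] × Δ[n]`. -/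
def Tot.eval {Y : SimplexCategory ⥤ SSet.{u}} {n : ℕ} (e : (Tot Y) _⦋n⦌) {m p : SimplexCategory}
    (a : m ⟶ p) (b : m ⟶ ⦋n⦌) : (Y.obj p).obj (op m) :=
  (NatTrans.app (show Simplices ⊗ (Functor.const SimplexCategory).obj Δ[n] ⟶ Y from e)
    p).app (op m) (SSet.stdSimplex.objEquiv.symm a, SSet.stdSimplex.objEquiv.symm b)

/-! ### Čech cochains, twisting cochains and their weak equivalences -/

/-- Families of matrices `u_{α₀ … αₚ}` over the sections on `U_{α₀ … αₚ}`. A cochain of total degree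
`s` has components `u_{α₀ … αₚ}` of degree `s - p` (see `IsCochain`). -/
abbrev Cochain : Type (max u v) :=
  ∀ (p : ℕ) (α : Fin (p + 1) → ι), GrMat (Sec (cechOpen U α))

namespace Cochain

variable {U}

/-- The restriction to `U_{α₀ … αₚ}` of the component of `u` at the face `θ` of `(α₀, …, αₚ)`. -/
noncomputable def face (u : Cochain U) {q p : ℕ} (θ : ⦋q⦌ ⟶ ⦋p⦌) (α : Fin (p + 1) → ι) :
    GrMat (Sec (cechOpen U α)) :=
  (u q (α ∘ θ.toOrderHom)).map (X.presheaf.map (homOfLE (cechOpen_le U θ α)).op).hom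

/-- `u` is an element of total degree `s` of the Čech bicomplex of morphisms from `A` to `B`
(families of graded free modules of ranks `A a`, `B a` on `U_a`): its component
`u_{α₀ … αₚ}` is a morphism from `A_{αₚ}` to `B_{α₀}` of degree `s - p`. -/
def IsCochain (A B : ι → ℤ →₀ ℕ) (s : ℤ) (u : Cochain U) : Prop :=
  ∀ (p : ℕ) (α : Fin (p + 1) → ι), IsHom (A (α (Fin.last p))) (B (α 0)) (s - p) (u p α)

/-- The deleted Čech differential:
`(δ̂ u)_{α₀ … αₚ} = ∑_{0 < j < p} (-1) ^ j u_{α₀ … (omit αⱼ) … αₚ}`. -/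
noncomputable def delta (u : Cochain U) : Cochain U := fun p => match p with
  | 0 => fun _ => 0
  | p + 1 => fun α => ∑ j : Fin p,
      ((j : ℤ) + 1).negOnePow • u.face (SimplexCategory.δ j.succ.castSucc) α

/-- The product `u · w` of a cochain `u` of total degree `s` and a cochain `w`, where `B` is the
family of ranks of the graded modules in the middle:
`(u · w)_{α₀ … αₚ} = ∑_{0 ≤ j ≤ p} (-1) ^ ((s - j) (p - j)) u_{α₀ … αⱼ} ∘ w_{αⱼ … αₚ}`, i.e. the sign
for components of bidegrees `(j, q)` and `(r, t)` is `(-1) ^ (q r)`. -/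
noncomputable def mul (B : ι → ℤ →₀ ℕ) (s : ℤ) (u w : Cochain U) : Cochain U := fun p α =>
  ∑ j : Fin (p + 1), ((s - j) * ((p : ℤ) - j)).negOnePow •
    comp (B (α j)) (u.face (front j) α) (w.face (back j) α)

end Cochain

/-- The data `(E^•, φ)` underlying a twisting cochain. -/
structure TwistingData where
  /-- the bounded complex of finite free modules on `U_a` -/
  cx : ∀ a : ι, FreeComplex (Sec (cechOpen U fun _ : Fin (0 + 1) => a))
  /-- the cochain -/
  φ : Cochain U

variable {U}

/-- The ranks of the complexes. -/
def TwistingData.rk (E : TwistingData U) (a : ι) : ℤ →₀ ℕ := (E.cx a).rk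

/-- `(E^•, φ)` is a twisting cochain. -/
structure IsTwistingCochain (E : TwistingData U) : Prop where
  /-- `φ_{α₀ … αₚ} : E_{αₚ} ⟶ E_{α₀}` has degree `1 - p` -/
  isCochain : E.φ.IsCochain E.rk E.rk 1
  /-- `φ_a` is the differential of `E_a` -/
  differential : ∀ a, E.φ 0 (fun _ => a) = (E.cx a).d
  /-- `φ_{aa}` is the identity -/
  unit : ∀ a, E.φ 1 (fun _ => a) = idMat _ (E.rk a)
  /-- the Maurer–Cartan equation `δ̂ φ + φ · φ = 0` -/
  maurerCartan : E.φ.delta + Cochain.mul E.rk 1 E.φ E.φ = 0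

/-- `Λ` is a weak equivalence of twisting cochains from `F = (F^•, ψ)` to `E = (E^•, φ)`. -/
structure IsWeakEquivalence (F E : TwistingData U) (Λ : Cochain U) : Prop where
  /-- `Λ` has degree `0`: `Λ_{α₀ … αₚ} : F_{αₚ} ⟶ E_{α₀}` has degree `- p` -/
  isCochain : Λ.IsCochain F.rk E.rk 0
  /-- `Λ` is closed: `δ̂ Λ + φ · Λ - Λ · ψ = 0` -/
  closed : Λ.delta + Cochain.mul E.rk 1 E.φ Λ - Cochain.mul F.rk 0 Λ F.φ = 0
  /-- `Λ_a : F_a ⟶ E_a` is a quasi-isomorphism of complexes of `𝒪`-modules on `U_a`, i.e. a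
  quasi-isomorphism on all stalks -/
  quasiIso : ∀ (a : ι) (x : X) (hx : x ∈ cechOpen U fun _ : Fin (0 + 1) => a),
    IsQuasiIso ((F.cx a).map (X.presheaf.germ _ x hx).hom)
      ((E.cx a).map (X.presheaf.germ _ x hx).hom)
      ((Λ 0 fun _ => a).map (X.presheaf.germ _ x hx).hom)

/-! ### Points and paths of the Čech totalisation -/

/-- The simplex of the dg-nerve of `Free(U_{α₀ … αₚ})` underlying a simplex of the Čech evaluation
of `twist`. -/
def component {p n : SimplexCategory} (s : ((cechTwist U).obj p).obj (op n))
    (α : Fin (p.len + 1) → ι) : DGSimplex (Sec (cechOpen U α)) n :=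
  (s α).1

/-- The data `(E^•, φ)` defined by a point of the totalisation: `E_a` is the label of the vertex of
`Δ[0]`, and `φ_{α₀ … αₚ}` is the label of the nondegenerate `p`-simplex of `Δ[p]`. -/
noncomputable def pointData (e : (Tot (cechTwist U)) _⦋0⦌) : TwistingData U where
  cx a := (component (Tot.eval e (𝟙 ⦋0⦌) (𝟙 ⦋0⦌)) fun _ => a).obj 0
  φ p α := (component (Tot.eval e (𝟙 ⦋p⦌) (SimplexCategory.const ⦋p⦌ ⦋0⦌ 0)) α).lab p (𝟙 ⦋p⦌)

/-- The map `[p + 1] ⟶ [1]` sending `0, …, m` to `0` and `m + 1, …, p + 1` to `1`. -/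
def step {p : ℕ} (m : Fin (p + 1)) : ⦋p + 1⦌ ⟶ ⦋1⦌ :=
  SimplexCategory.mkHom
    { toFun := fun i => if (i : ℕ) ≤ m then 0 else 1
      monotone' := fun i j h => by
        have h' : (i : ℕ) ≤ j := h
        dsimp only
        split_ifs
        · exact le_rfl
        · exact Fin.zero_le _
        · omega
        · exact le_rfl }

/-- The cochain defined by a path in the totalisation:
`λ_{α₀ … αₚ} = ∑_{0 ≤ m ≤ p} (-1) ^ m f_{Δₘ}`, where `f_{Δₘ}` is the label of the nondegenerate
`(p + 1)`-simplex `Δₘ` of `Δ[p] × Δ[1]` with the vertices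
`(0, 0), …, (m, 0), (m, 1), …, (p, 1)`. -/
noncomputable def pathCochain (l : (Tot (cechTwist U)) _⦋1⦌) : Cochain U := fun p α =>
  ∑ m : Fin (p + 1), (m : ℤ).negOnePow •
    (component (Tot.eval l (SimplexCategory.σ m) (step m)) α).lab (p + 1) (𝟙 ⦋p + 1⦌)

end TwistCech

namespace TwistCech

/-! ### Labels of the simplices of `Δ[p] × Δ[n]` -/

section Labels

variable {X : AlgebraicGeometry.RingedSpace.{u}} {ι : Type v} {U : ι → Opens X} {n : ℕ}
  (t : (Tot (cechTwist U)) _⦋n⦌)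

/-! An `n`-simplex of the totalisation labels every simplex of every `Δ[p] × Δ[n]`, compatibly with
faces and with restriction. When a vertex is labelled by its differential, the two terms of `∂`
become the extreme terms `j = 0` and `j = k + 1` of the sum of products in the dg-nerve equation,
which turns into a Maurer–Cartan equation for each simplex (`seqLabel_maurerCartan`). For a point
and the top simplex of `Δ[p]` this is `δ̂φ + φ·φ = 0`. The condition `φ_{aa} = id` holds because
this edge is degenerate.

For a path, the Maurer–Cartan equations of the simplices `Δ_m` triangulating the prism `Δ[p] × Δ[1]`
are added with signs `(-1)^m` (`sum_seqLabel_prism`). The diagonal faces shared by `Δ_m` and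
`Δ_{m+1}` cancel and the other inner faces are prism simplices over faces of `Δ[p]`: together they
give `-δ̂λ` (`sum_prism_faces`). Cutting `Δ_m` at a vertex of the bottom leaves a simplex of the
bottom followed by a shorter prism simplex; cutting it at a vertex of the top leaves a prism simplex
followed by a simplex of the top (`sum_triangle`). These cuts give `-φ·λ` and `λ·ψ`.

Finally `λ_a` labels an edge of the core. The triangles exhibiting its inverse are labelled by chain
homotopies (`DGSimplex.triangle_eq`), so `λ_a` is a homotopy equivalence. Labels point from the last
vertex to the first, hence `λ` goes from `F` to `E`. -/

theorem component_eval_comp {k m p : SimplexCategory} (σ : k ⟶ m) (a : m ⟶ p) (b : m ⟶ ⦋n⦌)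
    (α : Fin (p.len + 1) → ι) :
    component (Tot.eval t (σ ≫ a) (σ ≫ b)) α = (component (Tot.eval t a b) α).pullback σ := by
  let x : ((Simplices ⊗ (Functor.const SimplexCategory).obj Δ[n]).obj p).obj (op m) :=
    (show (Δ[p.len] ⊗ Δ[n] : SSet.{max u v}).obj (op m) from
      (SSet.stdSimplex.objEquiv.symm a, SSet.stdSimplex.objEquiv.symm b))
  have h := NatTrans.naturality_apply
    (NatTrans.app
      (show Simplices ⊗ (Functor.const SimplexCategory).obj Δ[n] ⟶ cechTwist U from t) p)
    σ.op x
  exact congrArg (fun s : ((cechTwist U).obj p).obj (op k) => (s α).1) h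

theorem component_eval_restrict {m p q : SimplexCategory} (θ : p ⟶ q) (a : m ⟶ p) (b : m ⟶ ⦋n⦌)
    (β : Fin (q.len + 1) → ι) :
    component (Tot.eval t (a ≫ θ) b) β =
      (component (Tot.eval t a b) (β ∘ θ.toOrderHom)).map
        (X.presheaf.map (homOfLE (cechOpen_le U θ β)).op).hom :=
  congrArg (fun g : (Simplices ⊗ (Functor.const SimplexCategory).obj Δ[n]).obj p ⟶
      (cechTwist U).obj q => ((g.app (op m)
      ((SSet.stdSimplex.objEquiv.symm a, SSet.stdSimplex.objEquiv.symm b) :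
        (Δ[p.len] ⊗ Δ[n] : SSet.{max u v}).obj (op m))
          : ((cechTwist U).obj q).obj (op m)) β).1)
    (NatTrans.naturality
      (show Simplices ⊗ (Functor.const SimplexCategory).obj Δ[n] ⟶ cechTwist U from t) θ)

/-- The complex over the point `(x, v)`. -/
noncomputable def vertexComplex (v : Fin (n + 1)) (x : ι) :
    FreeComplex (Sec (cechOpen U fun _ : Fin (0 + 1) => x)) :=
  (component (Tot.eval t (𝟙 ⦋0⦌) (SimplexCategory.const ⦋0⦌ ⦋n⦌ v)) fun _ => x).obj 0

/-- Vertex `i` is pulled back along `[0] ⟶ [m]` and then comes from `Δ[0]` by restriction to `U_{α₀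
… αₚ}`. Only ranks are compared, since the two complexes live over different rings and restriction
leaves ranks unchanged. -/
theorem component_eval_rk {m p : SimplexCategory} (a : m ⟶ p) (b : m ⟶ ⦋n⦌)
    (α : Fin (p.len + 1) → ι) (i : Fin (m.len + 1)) :
    ((component (Tot.eval t a b) α).obj i).rk =
      (vertexComplex t (b.toOrderHom i) (α (a.toOrderHom i))).rk := by
  have h1 := component_eval_comp t (SimplexCategory.const ⦋0⦌ m i) a b α
  have h2 := component_eval_restrict t (SimplexCategory.const ⦋0⦌ p (a.toOrderHom i))
    (𝟙 ⦋0⦌) (SimplexCategory.const ⦋0⦌ ⦋n⦌ (b.toOrderHom i)) α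
  exact congrArg (fun s => (DGSimplex.obj s 0).rk) (h1.symm.trans h2)

/-- The label of the simplex `(a, b)` of `Δ[p] × Δ[n]`. -/
noncomputable def label {p : ℕ} (α : Fin (p + 1) → ι) (k : ℕ) (a : ⦋k⦌ ⟶ ⦋p⦌) (b : ⦋k⦌ ⟶ ⦋n⦌) :
    GrMat (Sec (cechOpen U α)) :=
  (component (Tot.eval t a b) α).lab k (𝟙 ⦋k⦌)

theorem component_eval_lab {m p : ℕ} (a : ⦋m⦌ ⟶ ⦋p⦌) (b : ⦋m⦌ ⟶ ⦋n⦌)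
    (α : Fin (p + 1) → ι) (k : ℕ) (σ : ⦋k⦌ ⟶ ⦋m⦌) :
    (component (Tot.eval t a b) α).lab k σ = label t α k (σ ≫ a) (σ ≫ b) :=
  (congrArg ((component (Tot.eval t a b) α).lab k) (Category.id_comp σ)).symm.trans
    (congrArg (fun s => DGSimplex.lab s k (𝟙 ⦋k⦌)) (component_eval_comp t σ a b α)).symm

theorem label_map {p q k : ℕ} (θ : ⦋p⦌ ⟶ ⦋q⦌) (a : ⦋k⦌ ⟶ ⦋p⦌) (b : ⦋k⦌ ⟶ ⦋n⦌)
    (β : Fin (q + 1) → ι) :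
    (label t (β ∘ θ.toOrderHom) k a b).map (X.presheaf.map (homOfLE (cechOpen_le U θ β)).op).hom =
      label t β k (a ≫ θ) b :=
  (congrArg (fun s => DGSimplex.lab s k (𝟙 ⦋k⦌)) (component_eval_restrict t θ a b β)).symm

theorem label_isHom {p : ℕ} (α : Fin (p + 1) → ι) (k : ℕ) (a : ⦋k⦌ ⟶ ⦋p⦌) (b : ⦋k⦌ ⟶ ⦋n⦌) :
    IsHom (vertexComplex t (b.toOrderHom (Fin.last k)) (α (a.toOrderHom (Fin.last k)))).rk
      (vertexComplex t (b.toOrderHom 0) (α (a.toOrderHom 0))).rk (1 - (k : ℤ))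
      (label t α k a b) := by
  have h := (component (Tot.eval t a b) α).lab_isHom k (𝟙 ⦋k⦌)
  simp only [component_eval_rk] at h
  exact h

/-- Back faces have lengths such as `k + 1 - j`, which agree with the expected ones only
propositionally. Comparing vertices as natural numbers avoids transports. -/
theorem label_congr {p : ℕ} (α : Fin (p + 1) → ι) {k k' : ℕ} (hk : k = k')
    {a : ⦋k⦌ ⟶ ⦋p⦌} {b : ⦋k⦌ ⟶ ⦋n⦌} {a' : ⦋k'⦌ ⟶ ⦋p⦌} {b' : ⦋k'⦌ ⟶ ⦋n⦌}
    (ha : ∀ (i : ℕ) (hi : i < k + 1), (a.toOrderHom ⟨i, hi⟩ : ℕ) = a'.toOrderHom ⟨i, hk ▸ hi⟩)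
    (hb : ∀ (i : ℕ) (hi : i < k + 1), (b.toOrderHom ⟨i, hi⟩ : ℕ) = b'.toOrderHom ⟨i, hk ▸ hi⟩) :
    label t α k a b = label t α k' a' b' := by
  subst hk
  have ha' : a = a' := by
    ext i
    exact ha i i.2
  have hb' : b = b' := by
    ext i
    exact hb i i.2
  rw [ha', hb']

theorem component_eval_d {m p : ℕ} (a : ⦋m⦌ ⟶ ⦋p⦌) (b : ⦋m⦌ ⟶ ⦋n⦌)
    (α : Fin (p + 1) → ι) (i : Fin (m + 1)) :
    ((component (Tot.eval t a b) α).obj i).d =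
      label t α 0 (SimplexCategory.const ⦋0⦌ ⦋m⦌ i ≫ a) (SimplexCategory.const ⦋0⦌ ⦋m⦌ i ≫ b) :=
  ((component (Tot.eval t a b) α).lab_zero (SimplexCategory.const ⦋0⦌ ⦋m⦌ i)).symm.trans
    (component_eval_lab t a b α 0 _)

theorem label_eq {p : ℕ} (α : Fin (p + 1) → ι) (k : ℕ) (a : ⦋k + 1⦌ ⟶ ⦋p⦌)
    (b : ⦋k + 1⦌ ⟶ ⦋n⦌) :
    comp (vertexComplex t (b.toOrderHom (Fin.last (k + 1)))
        (α (a.toOrderHom (Fin.last (k + 1))))).rk (label t α (k + 1) a b)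
        (label t α 0 (SimplexCategory.const ⦋0⦌ ⦋k + 1⦌ (Fin.last (k + 1)) ≫ a)
          (SimplexCategory.const ⦋0⦌ ⦋k + 1⦌ (Fin.last (k + 1)) ≫ b)) +
      (-(k : ℤ) + 1).negOnePow • comp (vertexComplex t (b.toOrderHom 0) (α (a.toOrderHom 0))).rk
        (label t α 0 (SimplexCategory.const ⦋0⦌ ⦋k + 1⦌ 0 ≫ a)
          (SimplexCategory.const ⦋0⦌ ⦋k + 1⦌ 0 ≫ b)) (label t α (k + 1) a b) =
    ∑ j : Fin k, (j : ℤ).negOnePow •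
        label t α k (SimplexCategory.δ j.succ.castSucc ≫ a)
          (SimplexCategory.δ j.succ.castSucc ≫ b) +
      ∑ j : Fin k, (((k : ℤ) + 1) * j + 1).negOnePow •
        comp (vertexComplex t (b.toOrderHom j.succ.castSucc) (α (a.toOrderHom j.succ.castSucc))).rk
          (label t α _ (front j.succ.castSucc ≫ a) (front j.succ.castSucc ≫ b))
          (label t α _ (back j.succ.castSucc ≫ a) (back j.succ.castSucc ≫ b)) := by
  have h := (component (Tot.eval t a b) α).lab_eq k (𝟙 ⦋k + 1⦌)
  simp only [homDiff, component_eval_lab, component_eval_rk, component_eval_d,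
    Category.comp_id, Category.id_comp] at h
  exact h

theorem label_zero_comp {p : ℕ} (α : Fin (p + 1) → ι) (a : ⦋0⦌ ⟶ ⦋p⦌) (b : ⦋0⦌ ⟶ ⦋n⦌) :
    comp (vertexComplex t (b.toOrderHom 0) (α (a.toOrderHom 0))).rk
      (label t α 0 a b) (label t α 0 a b) = 0 := by
  have h := ((component (Tot.eval t a b) α).obj 0).d_comp_d
  rw [component_eval_d, component_eval_rk] at h
  have ha : SimplexCategory.const ⦋0⦌ ⦋0⦌ 0 = 𝟙 ⦋0⦌ := Subsingleton.elim _ _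
  simpa [ha] using h

/-! ### Labels of simplices given by monotone sequences -/

/-- The simplex of `Δ[p]` with vertices `f 0, …, f k`. -/
def seqHom (k p : ℕ) (f : ℕ →o ℕ) : ⦋k⦌ ⟶ ⦋p⦌ :=
  SimplexCategory.mkHom
    { toFun := fun i => ⟨min (f i) p, by omega⟩
      monotone' := fun i j h => by
        have := f.monotone (show (i : ℕ) ≤ j from h)
        simp only [Fin.mk_le_mk]
        omega }

/-- The increasing sequence that omits `j`. -/
def skip (j : ℕ) : ℕ →o ℕ where
  toFun i := if i < j then i else i + 1
  monotone' a b h := by dsimp only; split_ifs <;> omega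

/-- The sequence `j, j + 1, …`. -/
def shift (j : ℕ) : ℕ →o ℕ where
  toFun i := i + j
  monotone' _ _ h := Nat.add_le_add_right h _

@[simp]
theorem skip_apply (j i : ℕ) : skip j i = if i < j then i else i + 1 := rfl

@[simp]
theorem shift_apply (j i : ℕ) : shift j i = i + j := rfl

/-- The label of the simplex with vertices `(f 0, g 0), …, (f k, g k)`. -/
noncomputable def seqLabel {p : ℕ} (α : Fin (p + 1) → ι) (k : ℕ) (f g : ℕ →o ℕ) :
    GrMat (Sec (cechOpen U α)) :=
  label t α k (seqHom k p f) (seqHom k n g)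

/-- The ranks at the vertex `(i, v)`. -/
noncomputable def seqRk {p : ℕ} (α : Fin (p + 1) → ι) (i v : ℕ) : ℤ →₀ ℕ :=
  (vertexComplex t ⟨min v n, by omega⟩ (α ⟨min i p, by omega⟩)).rk

/-- Sequences on all of `ℕ`, truncated at `p` and `n`, reduce every simplicial identity below to
case distinctions in linear arithmetic. -/
theorem seqLabel_congr {p : ℕ} (α : Fin (p + 1) → ι) {k k' : ℕ} (hk : k = k')
    {f g f' g' : ℕ →o ℕ} (hf : ∀ i ≤ k, min (f i) p = min (f' i) p)
    (hg : ∀ i ≤ k, min (g i) n = min (g' i) n) :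
    seqLabel t α k f g = seqLabel t α k' f' g' :=
  label_congr t α hk (fun i hi => hf i (by omega)) (fun i hi => hg i (by omega))

theorem label_eq_seqLabel {p : ℕ} (α : Fin (p + 1) → ι) {k k' : ℕ} (hk : k = k')
    {a : ⦋k⦌ ⟶ ⦋p⦌} {b : ⦋k⦌ ⟶ ⦋n⦌} {f g : ℕ →o ℕ}
    (ha : ∀ (i : ℕ) (hi : i < k + 1), (a.toOrderHom ⟨i, hi⟩ : ℕ) = min (f i) p)
    (hb : ∀ (i : ℕ) (hi : i < k + 1), (b.toOrderHom ⟨i, hi⟩ : ℕ) = min (g i) n) :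
    label t α k a b = seqLabel t α k' f g :=
  label_congr t α hk ha hb

theorem δ_apply {k : ℕ} (j : Fin (k + 2)) (i : ℕ) (hi : i < k + 1) :
    (((SimplexCategory.δ j).toOrderHom ⟨i, hi⟩ : Fin (k + 2)) : ℕ) = skip j i := by
  simp only [SimplexCategory.δ, skip_apply, SimplexCategory.Hom.toOrderHom_mk,
    SimplexCategory.mkHom, OrderEmbedding.toOrderHom_coe, Fin.succAboveOrderEmb_apply,
    Fin.succAbove, Fin.lt_def]
  split_ifs <;> simp_all

theorem δ_seqHom_apply {k p : ℕ} (j : Fin (k + 2)) (f : ℕ →o ℕ) (i : ℕ) (hi : i < k + 1) :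
    ((SimplexCategory.δ j ≫ seqHom (k + 1) p f).toOrderHom ⟨i, hi⟩ : ℕ) =
      min (f (skip j i)) p := by
  rw [← δ_apply j i hi]
  rfl

/-- The labels of an arbitrary simplex satisfy the Maurer–Cartan equation. -/
theorem seqLabel_maurerCartan {p : ℕ} (α : Fin (p + 1) → ι) (k : ℕ) (f g : ℕ →o ℕ) :
    ∑ j ∈ Finset.range k, ((j : ℤ) + 1).negOnePow •
        seqLabel t α k (f.comp (skip (j + 1))) (g.comp (skip (j + 1))) +
      ∑ j ∈ Finset.range (k + 2), ((1 - (j : ℤ)) * ((k + 1 : ℤ) - (j : ℤ))).negOnePow •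
        comp (seqRk t α (f j) (g j)) (seqLabel t α j f g)
          (seqLabel t α (k + 1 - j) (f.comp (shift j)) (g.comp (shift j))) = 0 := by
  have h := label_eq t α k (seqHom (k + 1) p f) (seqHom (k + 1) n g)
  -- The split-off products `j = k + 1` and `j = 0` are the terms `f ∘ d` and `± d ∘ f` of `∂ f`.
  rw [Finset.sum_range_succ, Finset.sum_range_succ']
  simp only [Finset.sum_range]
  have h1 : ∀ j : Fin k, label t α k
      (SimplexCategory.δ j.succ.castSucc ≫ seqHom (k + 1) p f)
      (SimplexCategory.δ j.succ.castSucc ≫ seqHom (k + 1) n g) =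
      seqLabel t α k (f.comp (skip (j + 1))) (g.comp (skip (j + 1))) := fun j =>
    label_eq_seqLabel t α rfl (δ_seqHom_apply _ f) (δ_seqHom_apply _ g)
  have h2 : ∀ j : Fin (k + 2), label t α _
      (front j ≫ seqHom (k + 1) p f) (front j ≫ seqHom (k + 1) n g) = seqLabel t α j f g := fun j =>
    label_eq_seqLabel t α rfl (fun _ _ => rfl) (fun _ _ => rfl)
  have h3 : ∀ j : Fin (k + 2), label t α _
      (back j ≫ seqHom (k + 1) p f) (back j ≫ seqHom (k + 1) n g) =
        seqLabel t α (k + 1 - j) (f.comp (shift j)) (g.comp (shift j)) := fun j =>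
    label_eq_seqLabel t α rfl (fun _ _ => rfl) (fun _ _ => rfl)
  have h4 : label t α 0 (SimplexCategory.const ⦋0⦌ ⦋k + 1⦌ 0 ≫ seqHom (k + 1) p f)
      (SimplexCategory.const ⦋0⦌ ⦋k + 1⦌ 0 ≫ seqHom (k + 1) n g) = seqLabel t α 0 f g :=
    label_eq_seqLabel t α rfl (fun i hi => by obtain rfl : i = 0 := by omega
                                              rfl)
      (fun i hi => by obtain rfl : i = 0 := by omega
                      rfl)
  have h5 : label t α 0 (SimplexCategory.const ⦋0⦌ ⦋k + 1⦌ (Fin.last (k + 1)) ≫ seqHom (k + 1) p f)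
      (SimplexCategory.const ⦋0⦌ ⦋k + 1⦌ (Fin.last (k + 1)) ≫ seqHom (k + 1) n g) =
      seqLabel t α (k + 1 - (k + 1)) (f.comp (shift (k + 1))) (g.comp (shift (k + 1))) :=
    label_eq_seqLabel t α (by omega)
      (fun i hi => by obtain rfl : i = 0 := by omega
                      simp only [OrderHom.comp_coe, Function.comp, shift_apply, zero_add]
                      rfl)
      (fun i hi => by obtain rfl : i = 0 := by omega
                      simp only [OrderHom.comp_coe, Function.comp, shift_apply, zero_add]
                      rfl)
  have h6 : label t α (k + 1) (seqHom (k + 1) p f) (seqHom (k + 1) n g) =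
      seqLabel t α (k + 1 - 0) (f.comp (shift 0)) (g.comp (shift 0)) := rfl
  have h7 : label t α (k + 1) (seqHom (k + 1) p f) (seqHom (k + 1) n g) =
      seqLabel t α (k + 1) f g := rfl
  have h8 : ((1 - (((k + 1 : ℕ) : ℤ))) * ((k + 1 : ℤ) - ((k + 1 : ℕ) : ℤ))).negOnePow = 1 := by
    simp
  have h9 : ((1 - ((0 : ℕ) : ℤ)) * ((k + 1 : ℤ) - ((0 : ℕ) : ℤ))).negOnePow =
      (-(k : ℤ) + 1).negOnePow := by
    rw [Int.negOnePow_eq_iff]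
    exact ⟨k, by push_cast; ring⟩
  -- The nerve sign is opposite to the sign of the cochain product, as `i (i - 1)` is even; this
  -- matches moving the sum across the equation.
  have h10 : ∀ i : Fin k, ((1 - ((i + 1 : ℕ) : ℤ)) * ((k + 1 : ℤ) - ((i + 1 : ℕ) : ℤ))).negOnePow =
      -(((k : ℤ) + 1) * i + 1).negOnePow := fun i => by
    rw [← Int.negOnePow_succ, Int.negOnePow_eq_iff]
    push_cast
    rw [show (1 - ((i : ℤ) + 1)) * (k + 1 - (i + 1)) - ((k + 1) * i + 1 + 1) =
      (i : ℤ) * (i - 1) - (2 * (k * i) + 2) by ring]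
    exact (Int.even_mul_pred_self _).sub ⟨k * i + 1, by ring⟩
  rw [h4, h5] at h
  simp only [h1, h2, h3] at h
  have h11 : ∀ i : Fin k, ((i : ℤ) + 1).negOnePow = -(i : ℤ).negOnePow := fun i =>
    Int.negOnePow_succ _
  simp only [h8, h9, h10, h11, Units.neg_smul, Finset.sum_neg_distrib, one_smul, ← h6]
  rw [h7] at h ⊢
  have key : ∀ {A B C D : GrMat (Sec (cechOpen U α))}, A + B = C + D →
      -C + (-D + B + A) = 0 := fun {A B C D} hh => by
    rw [show -C + (-D + B + A) = A + B - (C + D) by abel, hh, sub_self]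
  exact key h

end Labels
/-! ### Rearrangement of signed sums -/

section Sums

variable {A : Type*} [AddCommGroup A]

/-- Each column `j` is cut into `m < j` and `m ≥ j`; the first piece is empty for `j = 0`, the
second for `j = p + 1`. -/
theorem sum_triangle (p : ℕ) (F : ℕ → ℕ → A) :
    ∑ m ∈ Finset.range (p + 1), ∑ j ∈ Finset.range (p + 2), F m j =
      ∑ j ∈ Finset.range (p + 1), ∑ m ∈ Finset.range (p - j + 1), F (j + m) j +
      ∑ j ∈ Finset.range (p + 1), ∑ m ∈ Finset.range (j + 1), F m (j + 1) := by
  have h : ∀ j ∈ Finset.range (p + 2), ∑ m ∈ Finset.range (p + 1), F m j =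
      ∑ m ∈ Finset.range j, F m j + ∑ m ∈ Finset.range (p + 1 - j), F (j + m) j := fun j hj => by
    have hj' : j + (p + 1 - j) = p + 1 := by
      have := Finset.mem_range.mp hj
      omega
    rw [← Finset.sum_range_add, hj']
  rw [Finset.sum_comm, Finset.sum_congr rfl h, Finset.sum_add_distrib, Finset.sum_range_succ',
    Finset.sum_range_succ (fun j => ∑ m ∈ Finset.range (p + 1 - j), F (j + m) j)]
  simp only [Finset.range_zero, Finset.sum_empty, Nat.sub_self, add_zero]
  rw [add_comm]
  refine congrArg (· + _) (Finset.sum_congr rfl fun j hj => ?_)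
  rw [Nat.sub_add_comm (Finset.mem_range_succ_iff.mp hj)]

/-- `X m J` stands for the `J`-th face of `Δ_m`, and `Y J m` for the `m`-th prism simplex over the
face of `Δ[p]` omitting `J`. The hypotheses are the face identities of the prism. -/
theorem sum_prism_faces (s : ℕ → ℤˣ) (hs : ∀ m, s (m + 1) = -s m) (p : ℕ) (X Y : ℕ → ℕ → A)
    (hdiag : ∀ m < p, X (m + 1) (m + 1) = X m (m + 1))
    (hlow : ∀ J m, J ≤ m → m < p → X (m + 1) J = Y J m)
    (hup : ∀ J m, m < J → J < p → X m (J + 1) = Y J m) :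
    ∑ m ∈ Finset.range (p + 1), s m • ∑ j ∈ Finset.range p, s (j + 1) • X m (j + 1) =
      -∑ j ∈ Finset.range (p - 1), s (j + 1) • ∑ m ∈ Finset.range p, s m • Y (j + 1) m := by
  obtain rfl | ⟨q, rfl⟩ : p = 0 ∨ ∃ q, p = q + 1 := by
    cases p <;> simp
  · simp
  let P : ℕ → A := fun j => ∑ m ∈ Finset.range j, s m • Y j m
  let T : ℕ → A := fun j => ∑ m ∈ Finset.range (q + 1), s m • Y j m
  -- In column `j + 1`, the terms `m = j` and `m = j + 1` cancel by `hdiag`. Those with `m < j` give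
  -- the initial part of row `j` of `Y`, those with `m > j + 1` give, after a shift of `m` and a
  -- change of sign, the tail of row `j + 1`.
  have hcol : ∀ j ∈ Finset.range (q + 1), ∑ m ∈ Finset.range (q + 1 + 1), s m • X m (j + 1) =
      P j - (T (j + 1) - P (j + 1)) := fun j hj => by
    obtain ⟨r, rfl⟩ := Nat.exists_eq_add_of_le (Finset.mem_range_succ_iff.mp hj)
    have hT : T (j + 1) - P (j + 1) =
        ∑ x ∈ Finset.range r, s (j + 1 + x) • Y (j + 1) (j + 1 + x) := by
      simp only [T, P, show j + r + 1 = j + 1 + r by omega, Finset.sum_range_add]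
      abel
    rw [hT, show j + r + 1 + 1 = j + 1 + 1 + r by omega, Finset.sum_range_add,
      Finset.sum_range_succ, Finset.sum_range_succ, hdiag j (by omega), hs, Units.neg_smul,
      add_neg_cancel_right, sub_eq_add_neg, ← Finset.sum_neg_distrib]
    congr 1
    · refine Finset.sum_congr rfl fun m hm => ?_
      rw [hup j m (Finset.mem_range.mp hm) (by omega)]
    · refine Finset.sum_congr rfl fun x hx => ?_
      have := Finset.mem_range.mp hx
      rw [show j + 1 + 1 + x = j + 1 + x + 1 by omega, hs, Units.neg_smul,
        hlow (j + 1) (j + 1 + x) (by omega) (by omega)]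
  have hswap : ∑ m ∈ Finset.range (q + 1 + 1), s m •
      ∑ j ∈ Finset.range (q + 1), s (j + 1) • X m (j + 1) =
      ∑ j ∈ Finset.range (q + 1), s (j + 1) •
        ∑ m ∈ Finset.range (q + 1 + 1), s m • X m (j + 1) := by
    simp only [Finset.smul_sum]
    rw [Finset.sum_comm]
    simp only [smul_comm (s _) (s _) (X _ _)]
  have hP : P 0 = 0 := Finset.sum_range_zero _
  have hQ : T (q + 1) - P (q + 1) = 0 := sub_self _
  rw [hswap, Finset.sum_congr rfl fun j hj => congrArg (s (j + 1) • ·) (hcol j hj)]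
  simp only [smul_sub (s _) (P _), Finset.sum_sub_distrib]
  -- Shifting `j` in the sum of the initial parts pairs each with the tail of the same row, and they
  -- add up to the full row. The two unpaired terms are empty sums.
  rw [Finset.sum_range_succ', Finset.sum_range_succ _ q, hP, hQ, smul_zero, smul_zero, add_zero,
    add_zero, ← Finset.sum_sub_distrib, ← Finset.sum_neg_distrib]
  refine Finset.sum_congr rfl fun j _ => ?_
  change s (j + 1 + 1) • P (j + 1) - s (j + 1) • (T (j + 1) - P (j + 1)) = -(s (j + 1) • T (j + 1))
  rw [hs, Units.neg_smul, smul_sub]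
  abel

end Sums

/-! ### Bilinearity of composition -/

section Comp

variable {R : Type u} [CommRing R] (r : ℤ →₀ ℕ)

theorem comp_sum_right {κ : Type*} (s : Finset κ) (M : GrMat R) (N : κ → GrMat R) :
    comp r M (∑ k ∈ s, N k) = ∑ k ∈ s, comp r M (N k) := by
  ext i j
  simp only [comp, Matrix.sum_apply, Finset.mul_sum]
  exact Finset.sum_comm

theorem comp_sum_left {κ : Type*} (s : Finset κ) (M : κ → GrMat R) (N : GrMat R) :
    comp r (∑ k ∈ s, M k) N = ∑ k ∈ s, comp r (M k) N := by
  ext i j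
  simp only [comp, Matrix.sum_apply, Finset.sum_mul]
  exact Finset.sum_comm

theorem comp_units_smul_right (c : ℤˣ) (M N : GrMat R) : comp r M (c • N) = c • comp r M N := by
  ext i j
  rcases Int.units_eq_one_or c with rfl | rfl <;> simp [comp]

theorem comp_units_smul_left (c : ℤˣ) (M N : GrMat R) : comp r (c • M) N = c • comp r M N := by
  ext i j
  rcases Int.units_eq_one_or c with rfl | rfl <;> simp [comp]

end Comp

/-! ### The prism decomposition -/

section Prism

/-- The increasing sequence that repeats `m`. -/
def dup (m : ℕ) : ℕ →o ℕ where
  toFun i := if i ≤ m then i else i - 1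
  monotone' a b h := by dsimp only; split_ifs <;> omega

/-- The sequence that is `0` up to `m` and `1` afterwards. -/
def jump (m : ℕ) : ℕ →o ℕ where
  toFun i := if i ≤ m then 0 else 1
  monotone' a b h := by dsimp only; split_ifs <;> omega

@[simp]
theorem dup_apply (m i : ℕ) : dup m i = if i ≤ m then i else i - 1 := rfl

@[simp]
theorem jump_apply (m i : ℕ) : jump m i = if i ≤ m then 0 else 1 := rfl

variable {X : AlgebraicGeometry.RingedSpace.{u}} {ι : Type v} {U : ι → Opens X} {n : ℕ}
  (t : (Tot (cechTwist U)) _⦋n⦌)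

/-- This is the closedness of `λ` written with labels: the negative of the alternating sum over `m`
of the Maurer–Cartan equations of the `Δ_m`. -/
theorem sum_seqLabel_prism {p : ℕ} (α : Fin (p + 1) → ι) :
    ∑ j ∈ Finset.range (p - 1), ((j : ℤ) + 1).negOnePow • ∑ m ∈ Finset.range p,
        (m : ℤ).negOnePow • seqLabel t α p ((skip (j + 1)).comp (dup m)) (jump m) +
      ∑ j ∈ Finset.range (p + 1), ((1 - (j : ℤ)) * ((p : ℤ) - j)).negOnePow •
        comp (seqRk t α j 0) (seqLabel t α j OrderHom.id (OrderHom.const ℕ 0))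
          (∑ m ∈ Finset.range (p - j + 1), (m : ℤ).negOnePow •
            seqLabel t α (p - j + 1) ((shift j).comp (dup m)) (jump m)) -
      ∑ j ∈ Finset.range (p + 1), ((0 - (j : ℤ)) * ((p : ℤ) - j)).negOnePow •
        comp (seqRk t α j 1) (∑ m ∈ Finset.range (j + 1), (m : ℤ).negOnePow •
            seqLabel t α (j + 1) (dup m) (jump m))
          (seqLabel t α (p - j) (shift j) (OrderHom.const ℕ 1)) = 0 := by
  have h := Finset.sum_congr (rfl : Finset.range (p + 1) = _) fun m _ =>
    congrArg ((m : ℤ).negOnePow • ·) (seqLabel_maurerCartan t α p (dup m) (jump m))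
  simp only [smul_zero, Finset.sum_const_zero] at h
  have hfaces := sum_prism_faces (fun m : ℕ => (m : ℤ).negOnePow)
    (fun m => by push_cast; exact Int.negOnePow_succ _) p
    (fun m J => seqLabel t α p ((dup m).comp (skip J)) ((jump m).comp (skip J)))
    (fun J m => seqLabel t α p ((skip J).comp (dup m)) (jump m))
    (fun m hm => seqLabel_congr t α rfl
      (fun i _ => congrArg (min · p) (by
        simp only [OrderHom.comp_coe, Function.comp, dup_apply, skip_apply]
        split_ifs <;> omega))
      (fun i _ => congrArg (min · n) (by
        simp only [OrderHom.comp_coe, Function.comp, jump_apply, skip_apply]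
        split_ifs <;> omega)))
    (fun J m hJ hm => seqLabel_congr t α rfl
      (fun i _ => congrArg (min · p) (by
        simp only [OrderHom.comp_coe, Function.comp, dup_apply, skip_apply]
        split_ifs <;> omega))
      (fun i _ => congrArg (min · n) (by
        simp only [OrderHom.comp_coe, Function.comp, jump_apply, skip_apply]
        split_ifs <;> omega)))
    (fun J m hJ hm => seqLabel_congr t α rfl
      (fun i _ => congrArg (min · p) (by
        simp only [OrderHom.comp_coe, Function.comp, dup_apply, skip_apply]
        split_ifs <;> omega))
      (fun i _ => congrArg (min · n) (by
        simp only [OrderHom.comp_coe, Function.comp, jump_apply, skip_apply]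
        split_ifs <;> omega)))
  simp only [smul_add, Finset.sum_add_distrib] at h
  push_cast at hfaces
  rw [hfaces] at h
  simp only [Finset.smul_sum (r := Int.negOnePow _) (s := Finset.range (p + 2))] at h
  -- Vertex `j` of `Δ_m` lies in the bottom exactly if `j ≤ m`.
  rw [sum_triangle] at h
  -- Cutting `Δ_{j+m}` at `(j, 0)` leaves `Δ_m` over the vertices `j, …, p`. Replacing `p` by `p +
  -- 1` in the sign contributes `(-1)^(1-j)`, which with the `(-1)^j` from the index `j + m` makes
  -- the overall minus.
  have h1 : ∀ j ∈ Finset.range (p + 1), ((1 - (j : ℤ)) * ((p : ℤ) - j)).negOnePow •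
        comp (seqRk t α j 0) (seqLabel t α j OrderHom.id (OrderHom.const ℕ 0))
          (∑ m ∈ Finset.range (p - j + 1), (m : ℤ).negOnePow •
            seqLabel t α (p - j + 1) ((shift j).comp (dup m)) (jump m)) = -
      ∑ m ∈ Finset.range (p - j + 1), ((j + m : ℕ) : ℤ).negOnePow •
        ((1 - (j : ℤ)) * ((p + 1 : ℤ) - (j : ℤ))).negOnePow •
        comp (seqRk t α (dup (j + m) j) (jump (j + m) j))
          (seqLabel t α j (dup (j + m)) (jump (j + m)))
          (seqLabel t α (p + 1 - j) ((dup (j + m)).comp (shift j))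
            ((jump (j + m)).comp (shift j))) := by
    intro j hj
    have hj' := Finset.mem_range_succ_iff.mp hj
    rw [comp_sum_right, Finset.smul_sum, ← Finset.sum_neg_distrib]
    refine Finset.sum_congr rfl fun m hm => ?_
    rw [comp_units_smul_right, smul_smul, smul_smul, ← Int.negOnePow_add, ← Int.negOnePow_add,
      ← Units.neg_smul, ← Int.negOnePow_succ]
    congr 1
    · rw [Int.negOnePow_eq_iff]
      push_cast
      exact ⟨-1, by ring⟩
    · congr 1
      · simp
      · refine seqLabel_congr t α rfl (fun i hi => congrArg (min · p) ?_)
          (fun i hi => congrArg (min · n) ?_)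
        · simp only [OrderHom.id_coe, id, dup_apply]
          split_ifs <;> omega
        · simp only [OrderHom.const_coe_coe, Function.const, jump_apply]
          split_ifs <;> omega
      · refine seqLabel_congr t α (by omega) (fun i hi => congrArg (min · p) ?_)
          (fun i hi => congrArg (min · n) ?_)
        · simp only [OrderHom.comp_coe, Function.comp, dup_apply, shift_apply]
          split_ifs <;> omega
        · simp only [OrderHom.comp_coe, Function.comp, jump_apply, shift_apply]
          split_ifs <;> omega
  -- For `m ≤ j`, vertex number `j + 1` of `Δ_m` is `(j, 1)`; cutting there leaves `Δ_m` over `0, …,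
  -- j`.
  have h2 : ∀ j ∈ Finset.range (p + 1), ((0 - (j : ℤ)) * ((p : ℤ) - j)).negOnePow •
        comp (seqRk t α j 1) (∑ m ∈ Finset.range (j + 1), (m : ℤ).negOnePow •
            seqLabel t α (j + 1) (dup m) (jump m))
          (seqLabel t α (p - j) (shift j) (OrderHom.const ℕ 1)) =
      ∑ m ∈ Finset.range (j + 1), (m : ℤ).negOnePow •
        ((1 - ((j + 1 : ℕ) : ℤ)) * ((p + 1 : ℤ) - ((j + 1 : ℕ) : ℤ))).negOnePow •
        comp (seqRk t α (dup m (j + 1)) (jump m (j + 1))) (seqLabel t α (j + 1) (dup m) (jump m))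
          (seqLabel t α (p + 1 - (j + 1)) ((dup m).comp (shift (j + 1)))
            ((jump m).comp (shift (j + 1)))) := by
    intro j hj
    have hj' := Finset.mem_range_succ_iff.mp hj
    rw [comp_sum_left, Finset.smul_sum]
    refine Finset.sum_congr rfl fun m hm => ?_
    have hm' := Finset.mem_range_succ_iff.mp hm
    rw [comp_units_smul_left, smul_smul, smul_smul, mul_comm]
    congr 1
    · congr 2
      push_cast
      ring
    · congr 1
      · simp [show ¬ j + 1 ≤ m by omega]
      · refine seqLabel_congr t α (by omega) (fun i hi => congrArg (min · p) ?_)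
          (fun i hi => congrArg (min · n) ?_)
        · simp only [OrderHom.comp_coe, Function.comp, dup_apply, shift_apply]
          split_ifs <;> omega
        · simp only [OrderHom.const_coe_coe, Function.const, OrderHom.comp_coe, Function.comp,
            jump_apply, shift_apply]
          split_ifs <;> omega
  rw [Finset.sum_congr rfl h1, Finset.sum_congr rfl h2, Finset.sum_neg_distrib]
  have key : ∀ {A B C : GrMat (Sec (cechOpen U α))}, -A + (B + C) = 0 → A + -B - C = 0 :=
    fun {A B C} hh => by rw [show A + -B - C = -(-A + (B + C)) by abel, hh, neg_zero]
  exact key h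

end Prism

/-! ### Points of the totalisation are twisting cochains -/

section Points

variable {X : AlgebraicGeometry.RingedSpace.{u}} {ι : Type v} {U : ι → Opens X}

/-- `U_{aa}` and `U_a` are not definitionally equal, so identities are carried between them by
restriction. -/
theorem presheaf_map_injective {V W : Opens X} (h : V ≤ W) (h' : W ≤ V) :
    Function.Injective (X.presheaf.map (homOfLE h).op).hom := by
  obtain rfl := le_antisymm h h'
  have : (homOfLE h).op = 𝟙 (op V) := rfl
  rw [this, CategoryTheory.Functor.map_id]
  exact fun _ _ hxy => hxy

theorem GrMat.map_injective {R S : Type u} [CommRing R] [CommRing S] {φ : R →+* S}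
    (hφ : Function.Injective φ) {M N : GrMat R} (h : M.map φ = N.map φ) : M = N := by
  ext i j
  exact hφ (congrFun (congrFun h i) j)

variable (e : (Tot (cechTwist U)) _⦋0⦌)

theorem pointData_cx (a : ι) : (pointData e).cx a = vertexComplex e 0 a := by
  have h : SimplexCategory.const ⦋0⦌ ⦋0⦌ 0 = 𝟙 ⦋0⦌ := Subsingleton.elim _ _
  rw [vertexComplex, h]
  rfl

theorem pointData_rk (a : ι) : (pointData e).rk a = (vertexComplex e 0 a).rk :=
  congrArg FreeComplex.rk (pointData_cx e a)

theorem pointData_face {p q : ℕ} (θ : ⦋q⦌ ⟶ ⦋p⦌) (α : Fin (p + 1) → ι) :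
    (pointData e).φ.face θ α = label e α q θ (SimplexCategory.const ⦋q⦌ ⦋0⦌ 0) := by
  refine (label_map e θ (𝟙 ⦋q⦌) (SimplexCategory.const ⦋q⦌ ⦋0⦌ 0) α).trans ?_
  rw [Category.id_comp]

theorem skip_lt {k i : ℕ} (j : ℕ) (hi : i < k + 1) : skip j i < k + 2 := by
  rw [skip_apply]
  split_ifs <;> omega

theorem pointData_maurerCartan :
    (pointData e).φ.delta + Cochain.mul (pointData e).rk 1 (pointData e).φ (pointData e).φ = 0 := by
  funext p α
  change (pointData e).φ.delta p α +
    Cochain.mul (pointData e).rk 1 (pointData e).φ (pointData e).φ p α = 0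
  cases p with
  | zero =>
    simp only [Cochain.delta, Cochain.mul, pointData_face]
    rw [Fin.sum_univ_one, zero_add]
    -- For `p = 0` the equation is `d ∘ d = 0`, a property of the complex itself; the nerve
    -- equations begin with edges.
    have h := label_zero_comp e α (𝟙 ⦋0⦌) (SimplexCategory.const ⦋0⦌ ⦋0⦌ 0)
    have hf : front (n := 0) 0 = 𝟙 ⦋0⦌ := Subsingleton.elim _ _
    have hb : back (n := 0) 0 = 𝟙 ⦋0⦌ := Subsingleton.elim _ _
    rw [hf, hb]
    refine (congrArg _ ?_).trans (smul_zero (_ : ℤˣ))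
    rw [pointData_rk]
    exact h
  | succ k =>
    have h := seqLabel_maurerCartan e α k OrderHom.id (OrderHom.const ℕ 0)
    simp only [Finset.sum_range] at h
    refine Eq.trans ?_ h
    simp only [Cochain.delta, Cochain.mul, pointData_face]
    congr 1
    · refine Finset.sum_congr rfl fun j _ => congrArg _ (label_eq_seqLabel e α rfl
        (fun i hi => ?_) (fun i hi => rfl))
      rw [δ_apply]
      have := skip_lt (j + 1) hi
      exact (min_eq_left (by exact Nat.le_of_lt_succ this)).symm
    · refine Finset.sum_congr rfl fun j _ => ?_
      refine congrArg _ ?_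
      rw [pointData_rk]
      congr 1
      · refine congrArg (fun x => (vertexComplex e 0 (α x)).rk) (Fin.ext ?_)
        exact (min_eq_left (Nat.le_of_lt_succ j.2)).symm
      · refine label_eq_seqLabel e α rfl (fun i hi => ?_) (fun i hi => rfl)
        exact (min_eq_left (show i ≤ k + 1 by omega)).symm
      · refine label_eq_seqLabel e α rfl (fun i hi => ?_) (fun i hi => rfl)
        exact (min_eq_left (show i + j ≤ k + 1 by omega)).symm

/-- By naturality along `[1] ⟶ [0]`, the restriction of `φ_{aa}` to `U_a` labels the degenerate edge
of `Δ[0]`, hence is the identity. -/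
theorem pointData_unit (a : ι) :
    (pointData e).φ 1 (fun _ => a) = idMat _ ((pointData e).rk a) := by
  have h := label_map e (SimplexCategory.σ (0 : Fin 1)) (𝟙 ⦋1⦌) (SimplexCategory.const ⦋1⦌ ⦋0⦌ 0)
    (fun _ => a)
  have h' := component_eval_lab e (𝟙 ⦋0⦌) (𝟙 ⦋0⦌) (fun _ => a) 1 (SimplexCategory.σ (0 : Fin 1))
  rw [DGSimplex.lab_id _ _ (Subsingleton.elim (α := Fin 1) _ _)] at h'
  have hc : SimplexCategory.σ (0 : Fin 1) ≫ 𝟙 ⦋0⦌ = SimplexCategory.const ⦋1⦌ ⦋0⦌ 0 :=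
    Subsingleton.elim _ _
  rw [Category.id_comp] at h
  refine GrMat.map_injective (presheaf_map_injective (V := cechOpen U fun _ : Fin (0 + 1) => a)
    (W := cechOpen U fun _ : Fin (1 + 1) => a) ?_ ?_) (h.trans (Eq.trans ?_ (idMat_map _ _).symm))
  · exact cechOpen_le U (SimplexCategory.σ (0 : Fin 1)) fun _ => a
  · exact cechOpen_le U (SimplexCategory.δ (0 : Fin 2)) fun _ => a
  · rw [hc] at h'
    rw [← Category.comp_id (SimplexCategory.σ (0 : Fin 1)), hc]
    refine h'.symm.trans ?_
    rw [pointData_rk]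
    exact congrArg (idMat _) (component_eval_rk e (𝟙 ⦋0⦌) (𝟙 ⦋0⦌) (fun _ => a) 0)

theorem isTwistingCochain_pointData : IsTwistingCochain (pointData e) where
  isCochain p α := by
    rw [pointData_rk, pointData_rk]
    exact label_isHom e α p (𝟙 ⦋p⦌) (SimplexCategory.const ⦋p⦌ ⦋0⦌ 0)
  differential a := by
    have h : SimplexCategory.const ⦋0⦌ ⦋0⦌ 0 = 𝟙 ⦋0⦌ := Subsingleton.elim _ _
    change (component (Tot.eval e (𝟙 ⦋0⦌) (SimplexCategory.const ⦋0⦌ ⦋0⦌ 0)) fun _ => a).lab 0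
      (𝟙 ⦋0⦌) = _
    rw [h]
    exact (component (Tot.eval e (𝟙 ⦋0⦌) (𝟙 ⦋0⦌)) fun _ => a).lab_zero (𝟙 ⦋0⦌)
  unit := pointData_unit e
  maurerCartan := pointData_maurerCartan e

end Points

/-! ### Paths in the totalisation give closed cochains of degree zero -/

section Paths

variable {X : AlgebraicGeometry.RingedSpace.{u}} {ι : Type v} {U : ι → Opens X}
  (l : (Tot (cechTwist U)) _⦋1⦌)

theorem label_map_const (v : Fin 2) {p q : ℕ} (α : Fin (p + 1) → ι) (a : ⦋q⦌ ⟶ ⦋p⦌) :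
    label ((Tot (cechTwist U)).map (SimplexCategory.const ⦋0⦌ ⦋1⦌ v).op l) α q a
      (SimplexCategory.const ⦋q⦌ ⦋0⦌ 0) = label l α q a (SimplexCategory.const ⦋q⦌ ⦋1⦌ v) := rfl

theorem pathCochain_face {p q : ℕ} (θ : ⦋q⦌ ⟶ ⦋p⦌) (α : Fin (p + 1) → ι) :
    (pathCochain l).face θ α = ∑ m : Fin (q + 1), (m : ℤ).negOnePow •
      label l α (q + 1) (SimplexCategory.σ m ≫ θ) (step m) := by
  rw [Cochain.face, pathCochain, sum_map]
  refine Finset.sum_congr rfl fun m _ => ?_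
  rw [negOnePow_smul_map]
  exact congrArg _ (label_map l θ (SimplexCategory.σ m) (step m) α)

theorem pathCochain_apply {p : ℕ} (α : Fin (p + 1) → ι) :
    pathCochain l p α = ∑ m : Fin (p + 1), (m : ℤ).negOnePow •
      label l α (p + 1) (SimplexCategory.σ m) (step m) := rfl

theorem σ_apply {k : ℕ} (j : Fin (k + 1)) (i : ℕ) (hi : i < k + 2) :
    (((SimplexCategory.σ j).toOrderHom ⟨i, hi⟩ : Fin (k + 1)) : ℕ) = dup j i := by
  change ((Fin.predAbove j ⟨i, hi⟩ : Fin (k + 1)) : ℕ) = if i ≤ j then i else i - 1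
  rw [Fin.predAbove]
  simp only [Fin.lt_def, Fin.val_castSucc]
  split_ifs <;> first | omega | rfl

theorem label_prism {p q : ℕ} (θ : ⦋q⦌ ⟶ ⦋p⦌) (α : Fin (p + 1) → ι) (f : ℕ →o ℕ)
    (hf : ∀ (i : ℕ) (hi : i < q + 1), (θ.toOrderHom ⟨i, hi⟩ : ℕ) = f i) (m : Fin (q + 1)) :
    label l α (q + 1) (SimplexCategory.σ m ≫ θ) (step m) =
      seqLabel l α (q + 1) (f.comp (dup m)) (jump m) := by
  refine label_eq_seqLabel l α rfl (fun i hi => ?_) (fun i hi => ?_)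
  · have h := σ_apply m i hi
    have h2 := hf (dup m i) (by rw [← h]; exact Fin.is_lt _)
    have h3 : (SimplexCategory.σ m).toOrderHom ⟨i, hi⟩ =
        ⟨dup m i, by rw [← h]; exact Fin.is_lt _⟩ :=
      Fin.ext h
    have h4 : ((SimplexCategory.σ m ≫ θ).toOrderHom ⟨i, hi⟩ : ℕ) = f (dup m i) := by
      rw [← h2, ← h3]
      rfl
    rw [h4]
    refine (min_eq_left ?_).symm
    change f (dup m i) ≤ p
    rw [← h4]
    exact Nat.le_of_lt_succ (Fin.is_lt _)
  · change ((if i ≤ m then 0 else 1 : Fin 2) : ℕ) = min (if i ≤ m then 0 else 1) 1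
    split_ifs <;> rfl

theorem pathCochain_face_seq {p q : ℕ} (θ : ⦋q⦌ ⟶ ⦋p⦌) (α : Fin (p + 1) → ι) (f : ℕ →o ℕ)
    (hf : ∀ (i : ℕ) (hi : i < q + 1), (θ.toOrderHom ⟨i, hi⟩ : ℕ) = f i) :
    (pathCochain l).face θ α = ∑ m ∈ Finset.range (q + 1), (m : ℤ).negOnePow •
      seqLabel l α (q + 1) (f.comp (dup m)) (jump m) := by
  rw [pathCochain_face, Finset.sum_range]
  exact Finset.sum_congr rfl fun m _ => congrArg _ (label_prism l θ α f hf m)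

theorem pathCochain_closed :
    (pathCochain l).delta +
      Cochain.mul
        (pointData ((Tot (cechTwist U)).map (SimplexCategory.const ⦋0⦌ ⦋1⦌ 0).op l)).rk 1
        (pointData ((Tot (cechTwist U)).map (SimplexCategory.const ⦋0⦌ ⦋1⦌ 0).op l)).φ
        (pathCochain l) -
      Cochain.mul
        (pointData ((Tot (cechTwist U)).map (SimplexCategory.const ⦋0⦌ ⦋1⦌ 1).op l)).rk 0
        (pathCochain l)
        (pointData ((Tot (cechTwist U)).map (SimplexCategory.const ⦋0⦌ ⦋1⦌ 1).op l)).φ = 0 := by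
  funext p α
  refine Eq.trans ?_ (sum_seqLabel_prism l α)
  have hrk : ∀ (v : Fin 2) (j : Fin (p + 1)),
      (pointData ((Tot (cechTwist U)).map (SimplexCategory.const ⦋0⦌ ⦋1⦌ v).op l)).rk (α j) =
        seqRk l α j v := fun v j => by
    rw [pointData_rk]
    have hj : (⟨min j p, by omega⟩ : Fin (p + 1)) = j :=
      Fin.ext (min_eq_left (Nat.le_of_lt_succ j.2))
    have hv : (⟨min v 1, by omega⟩ : Fin 2) = v :=
      Fin.ext (min_eq_left (Nat.le_of_lt_succ v.2))
    rw [seqRk, hj, hv]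
    rfl
  have hpt : ∀ (v : Fin 2) (q : ℕ) (θ : ⦋q⦌ ⟶ ⦋p⦌) (f : ℕ →o ℕ),
      (∀ (i : ℕ) (hi : i < q + 1), (θ.toOrderHom ⟨i, hi⟩ : ℕ) = f i) →
      (pointData ((Tot (cechTwist U)).map (SimplexCategory.const ⦋0⦌ ⦋1⦌ v).op l)).φ.face θ α =
        seqLabel l α q f (OrderHom.const ℕ v) := fun v q θ f hf => by
    rw [pointData_face, label_map_const]
    refine label_eq_seqLabel l α rfl (fun i hi => ?_) (fun i hi => ?_)
    · rw [hf]
      refine (min_eq_left ?_).symm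
      rw [← hf i hi]
      exact Nat.le_of_lt_succ (Fin.is_lt _)
    · exact (min_eq_left (Nat.le_of_lt_succ v.2)).symm
  change (pathCochain l).delta p α + Cochain.mul _ 1 _ _ p α - Cochain.mul _ 0 _ _ p α = _
  simp only [Cochain.mul, hrk, Finset.sum_range (n := p + 1)]
  congr 1
  · congr 1
    · cases p with
      | zero => simp [Cochain.delta]
      | succ k =>
        simp only [Cochain.delta, Nat.add_sub_cancel, Finset.sum_range (n := k)]
        refine Finset.sum_congr rfl fun j _ => congrArg _ ?_
        exact pathCochain_face_seq l _ α (skip (j + 1)) fun i hi => δ_apply _ i hi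
    · refine Finset.sum_congr rfl fun j _ => congrArg _ ?_
      rw [hpt 0 j (front j) OrderHom.id fun _ _ => rfl,
        pathCochain_face_seq l (back j) α (shift j) fun _ _ => rfl]
      rfl
  · refine Finset.sum_congr rfl fun j _ => congrArg _ ?_
    rw [hpt 1 (p - j) (back j) (shift j) fun _ _ => rfl,
      pathCochain_face_seq l (front j) α OrderHom.id fun _ _ => rfl]
    rfl

theorem pathCochain_isCochain :
    (pathCochain l).IsCochain
      (pointData ((Tot (cechTwist U)).map (SimplexCategory.const ⦋0⦌ ⦋1⦌ 1).op l)).rk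
      (pointData ((Tot (cechTwist U)).map (SimplexCategory.const ⦋0⦌ ⦋1⦌ 0).op l)).rk 0 := by
  intro p α i j hij
  rw [pathCochain_apply, Matrix.sum_apply] at hij
  obtain ⟨m, _, hm⟩ := Finset.exists_ne_zero_of_sum_ne_zero hij
  have hm' : label l α (p + 1) (SimplexCategory.σ m) (step m) i j ≠ 0 := fun h0 => hm (by
    rw [Matrix.smul_apply, h0, smul_zero])
  have h := label_isHom l α (p + 1) (SimplexCategory.σ m) (step m) i j hm'
  -- Every `Δ_m` starts at `(0, 0)` and ends at `(p, 1)`, so all summands have the same source and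
  -- target.
  have hl : (SimplexCategory.σ m).toOrderHom (Fin.last (p + 1)) = Fin.last p := by
    refine Fin.ext ((σ_apply m (p + 1) (by omega)).trans ?_)
    simp [show ¬ p + 1 ≤ m by omega]
  have h0 : (SimplexCategory.σ m).toOrderHom 0 = 0 :=
    Fin.ext ((σ_apply m 0 (by omega)).trans (by simp))
  have sl : (step m).toOrderHom (Fin.last (p + 1)) = 1 := if_neg (by simp; omega)
  have s0 : (step m).toOrderHom 0 = 0 := by
    change (if (0 : ℕ) ≤ m then (0 : Fin 2) else 1) = 0
    simp
  rw [hl, h0, sl, s0] at h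
  refine ⟨?_, ?_, ?_⟩
  · rw [pointData_rk]
    exact h.1
  · rw [pointData_rk]
    exact h.2.1
  · have h3 := h.2.2
    push_cast at h3 ⊢
    omega

end Paths

/-! ### Homotopy equivalences of complexes of free modules -/

section Homotopy

variable {R : Type u} [CommRing R]

/-- As `N` is homogeneous of degree `n`, only basis elements of degree `k + n` contribute to the sum
over the middle module. -/
theorem block_comp {r s t : ℤ →₀ ℕ} {n k m l : ℤ} {M N : GrMat R} (hN : IsHom r s n N)
    (hm : m = k + n) : block r t k l (comp s M N) = block s t m l M * block r s k m N := by
  ext b a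
  simp only [block, comp, basis, Finset.sum_sigma, Matrix.mul_apply]
  rw [Finset.sum_eq_single m]
  · exact Finset.sum_range _
  · intro i _ hi
    refine Finset.sum_eq_zero fun c _ => ?_
    by_contra hne
    exact hi ((hN ⟨i, c⟩ ⟨k, a⟩ (right_ne_zero_of_mul hne)).2.2.trans hm.symm)
  · intro hk
    have : s m = 0 := by simpa using hk
    simp [this]

/-- The component of a graded morphism as a morphism of modules. -/
noncomputable def blockHom (C D : FreeComplex R) (f : GrMat R) (i j : ℤ) :
    C.toCochainComplex.X i ⟶ D.toCochainComplex.X j :=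
  ModuleCat.ofHom (Matrix.toLin' (block C.rk D.rk i j f))

theorem blockHom_comp {C D E : FreeComplex R} {n i m j : ℤ} {f g : GrMat R}
    (hf : IsHom C.rk D.rk n f) (hm : m = i + n) :
    blockHom C D f i m ≫ blockHom D E g m j = blockHom C E (comp D.rk g f) i j := by
  rw [blockHom, blockHom, blockHom, block_comp hf hm, Matrix.toLin'_mul, ModuleCat.ofHom_comp]
  rfl

theorem blockHom_add (C D : FreeComplex R) (f g : GrMat R) (i j : ℤ) :
    blockHom C D (f + g) i j = blockHom C D f i j + blockHom C D g i j := by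
  have : block C.rk D.rk i j (f + g) = block C.rk D.rk i j f + block C.rk D.rk i j g := rfl
  rw [blockHom, this, map_add, ModuleCat.ofHom_add]
  rfl

theorem blockHom_eq_zero {C D : FreeComplex R} {n i j : ℤ} {f : GrMat R}
    (hf : IsHom C.rk D.rk n f) (h : j ≠ i + n) : blockHom C D f i j = 0 := by
  have : block C.rk D.rk i j f = 0 := by
    ext b a
    by_contra hne
    exact h (hf _ _ hne).2.2
  rw [blockHom, this, map_zero]
  rfl

theorem blockHom_idMat (C : FreeComplex R) (i : ℤ) : blockHom C C (idMat R C.rk) i i = 𝟙 _ := by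
  have : block C.rk C.rk i i (idMat R C.rk) = 1 := by
    ext b a
    have hb : (⟨i, b⟩ : Idx) ∈ basis C.rk := mem_basis.mpr b.2
    simp [block, idMat, Matrix.one_apply, hb, Fin.ext_iff]
  rw [blockHom, this, Matrix.toLin'_one]
  rfl

theorem toCochainComplex_d (C : FreeComplex R) (i j : ℤ) :
    C.toCochainComplex.d i j = blockHom C C C.d i j := by
  by_cases h : i + 1 = j
  · subst h
    exact CochainComplex.of_d (fun k => ModuleCat.of R (Fin (C.rk k) → R))
      (fun k => ModuleCat.ofHom (Matrix.toLin' (block C.rk C.rk k (k + 1) C.d))) i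
  · rw [blockHom_eq_zero C.d_isHom fun h' => h h'.symm]
    exact CochainComplex.of_d_ne (fun k => ModuleCat.of R (Fin (C.rk k) → R))
      (fun k => ModuleCat.ofHom (Matrix.toLin' (block C.rk C.rk k (k + 1) C.d))) h

/-- The chain map defined by a closed morphism of degree `0`. -/
noncomputable def chainMap (C D : FreeComplex R) (f : GrMat R) (hf : IsHom C.rk D.rk 0 f)
    (h : comp C.rk f C.d = comp D.rk D.d f) : C.toCochainComplex ⟶ D.toCochainComplex where
  f i := blockHom C D f i i
  comm' i j hij := by
    obtain rfl : i + 1 = j := hij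
    rw [toCochainComplex_d, toCochainComplex_d, blockHom_comp hf (by simp),
      blockHom_comp C.d_isHom rfl, h]

/-- The chain homotopy defined by a morphism of degree `-1`. -/
noncomputable def chainHomotopy {C D : FreeComplex R}
    {φ ψ : C.toCochainComplex ⟶ D.toCochainComplex}
    {f g h : GrMat R} (hφ : ∀ i, φ.f i = blockHom C D f i i) (hψ : ∀ i, ψ.f i = blockHom C D g i i)
    (hh : IsHom C.rk D.rk (-1) h) (heq : f = comp C.rk h C.d + comp D.rk D.d h + g) :
    Homotopy φ ψ where
  hom i j := blockHom C D h i j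
  zero i j hij := blockHom_eq_zero hh fun h' => hij (show j + 1 = i by omega)
  comm i := by
    rw [dNext_eq _ (show (ComplexShape.up ℤ).Rel i (i + 1) from rfl),
      prevD_eq _ (show (ComplexShape.up ℤ).Rel (i - 1) i from sub_add_cancel i 1),
      toCochainComplex_d, toCochainComplex_d, blockHom_comp C.d_isHom rfl,
      blockHom_comp hh (sub_eq_add_neg i 1), hφ, hψ, ← blockHom_add, ← blockHom_add, ← heq]

theorem IsQuasiIso.of_homotopy {C D : FreeComplex R} {f g h k : GrMat R}
    (hf : IsHom C.rk D.rk 0 f) (hg : IsHom D.rk C.rk 0 g)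
    (hfd : comp C.rk f C.d = comp D.rk D.d f) (hgd : comp D.rk g D.d = comp C.rk C.d g)
    (hh : IsHom C.rk C.rk (-1) h) (hk : IsHom D.rk D.rk (-1) k)
    (hgf : comp C.rk h C.d + comp C.rk C.d h = idMat R C.rk - comp D.rk g f)
    (hfg : comp D.rk k D.d + comp D.rk D.d k = idMat R D.rk - comp C.rk f g) :
    IsQuasiIso C D f := by
  refine ⟨chainMap C D f hf hfd, fun _ => rfl, ?_⟩
  let e : HomotopyEquiv C.toCochainComplex D.toCochainComplex :=
    { hom := chainMap C D f hf hfd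
      inv := chainMap D C g hg hgd
      homotopyHomInvId := (chainHomotopy (f := idMat R C.rk) (g := comp D.rk g f) (h := h)
        (fun i => (blockHom_idMat C i).symm) (fun i => blockHom_comp hf (by simp)) hh
        (by rw [hgf, sub_add_cancel])).symm
      homotopyInvHomId := (chainHomotopy (f := idMat R D.rk) (g := comp C.rk f g) (h := k)
        (fun i => (blockHom_idMat D i).symm) (fun i => blockHom_comp hg (by simp)) hk
        (by rw [hfg, sub_add_cancel])).symm }
  exact e.quasiIso_hom

end Homotopy

/-! ### Invertible edges of the dg-nerve -/

section Core

variable {R : Type u} [CommRing R]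

theorem DGSimplex.edge_isHom (s : DGSimplex R ⦋1⦌) :
    IsHom (s.obj 1).rk (s.obj 0).rk 0 (s.lab 1 (𝟙 ⦋1⦌)) :=
  s.lab_isHom 1 (𝟙 ⦋1⦌)

/-- An edge has no inner vertices, so the nerve equation is `∂ f = 0`. -/
theorem DGSimplex.edge_closed (s : DGSimplex R ⦋1⦌) :
    comp (s.obj 1).rk (s.lab 1 (𝟙 ⦋1⦌)) (s.obj 1).d =
      comp (s.obj 0).rk (s.obj 0).d (s.lab 1 (𝟙 ⦋1⦌)) := by
  have h := s.lab_eq 0 (𝟙 ⦋1⦌)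
  simp only [homDiff, Finset.univ_eq_empty, Finset.sum_empty, add_zero] at h
  have h1 : (-((0 : ℕ) : ℤ) + 1).negOnePow = -1 := rfl
  rw [h1, Units.neg_smul, one_smul, ← sub_eq_add_neg] at h
  exact sub_eq_zero.mp h

/-- The only inner vertex is `1`: the label of the triangle is a homotopy between `f₀₂` and `f₀₁ ∘
f₁₂`. -/
theorem DGSimplex.triangle_eq (w : DGSimplex R ⦋2⦌) :
    comp (w.obj 2).rk (w.lab 2 (𝟙 ⦋2⦌)) (w.obj 2).d +
        comp (w.obj 0).rk (w.obj 0).d (w.lab 2 (𝟙 ⦋2⦌)) =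
      w.lab 1 (SimplexCategory.δ 1) -
        comp (w.obj 1).rk (w.lab 1 (SimplexCategory.δ 2)) (w.lab 1 (SimplexCategory.δ 0)) := by
  have h := w.lab_eq 1 (𝟙 ⦋2⦌)
  simp only [homDiff, Category.comp_id] at h
  rw [Fin.sum_univ_one, Fin.sum_univ_one] at h
  have h1 : (-((1 : ℕ) : ℤ) + 1).negOnePow = 1 := rfl
  have h2 : ((((1 : ℕ) : ℤ) + 1) * ((0 : Fin 1) : ℕ) + 1).negOnePow = -1 := rfl
  have h3 : (((0 : Fin 1) : ℕ) : ℤ).negOnePow = 1 := rfl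
  rw [h1, h2, h3, Units.neg_smul, one_smul, one_smul, one_smul, ← sub_eq_add_neg] at h
  have hfr : front (n := 2) (Fin.castSucc (Fin.succ (0 : Fin 1))) = SimplexCategory.δ 2 := by
    ext i
    fin_cases i <;> rfl
  have hba : back (n := 2) (Fin.castSucc (Fin.succ (0 : Fin 1))) = SimplexCategory.δ 0 := by
    ext i
    fin_cases i <;> rfl
  exact h.trans (congrArg₂ (fun x y => w.lab 1 (SimplexCategory.δ 1) - comp (w.obj 1).rk x y)
    (congrArg (w.lab 1) hfr) (congrArg (w.lab 1) hba))

theorem DGSimplex.triangle_isHom (w : DGSimplex R ⦋2⦌) :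
    IsHom (w.obj 2).rk (w.obj 0).rk (-1) (w.lab 2 (𝟙 ⦋2⦌)) :=
  w.lab_isHom 2 (𝟙 ⦋2⦌)

/-- A triangle in the dg-nerve exhibiting the identity as a composition is a homotopy. -/
theorem exists_homotopy_of_compStruct {x y : (dgNerve R) _⦋0⦌} {e : SSet.Edge x y}
    {e' : SSet.Edge y x} (w : SSet.Edge.CompStruct e e' (SSet.Edge.id x))
    (s s' : DGSimplex R ⦋1⦌) (hs : e.edge = s) (hs' : e'.edge = s') :
    s.obj 0 = s'.obj 1 ∧ s.obj 1 = s'.obj 0 ∧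
      ∃ h, IsHom (s.obj 0).rk (s.obj 0).rk (-1) h ∧
        comp (s.obj 0).rk h (s.obj 0).d + comp (s.obj 0).rk (s.obj 0).d h =
          idMat R (s.obj 0).rk - comp (s.obj 1).rk (s.lab 1 (𝟙 ⦋1⦌)) (s'.lab 1 (𝟙 ⦋1⦌)) := by
  let W : DGSimplex R ⦋2⦌ := w.simplex
  -- The faces `d₂`, `d₀`, `d₁` of the triangle are `e`, `e'` and the degenerate edge at `x`; the
  -- label of the last is the identity.
  have h2 : W.pullback (SimplexCategory.δ 2) = s := w.d₂.trans hs
  have h0 : W.pullback (SimplexCategory.δ 0) = s' := w.d₀.trans hs'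
  have h1 : W.pullback (SimplexCategory.δ 1) = DGSimplex.pullback (SimplexCategory.σ 0) x := w.d₁
  have o20 : W.obj 0 = s.obj 0 := congrArg (fun z => DGSimplex.obj z 0) h2
  have o21 : W.obj 1 = s.obj 1 := congrArg (fun z => DGSimplex.obj z 1) h2
  have o00 : W.obj 1 = s'.obj 0 := congrArg (fun z => DGSimplex.obj z 0) h0
  have o01 : W.obj 2 = s'.obj 1 := congrArg (fun z => DGSimplex.obj z 1) h0
  have o10 : W.obj 0 = DGSimplex.obj x 0 := congrArg (fun z => DGSimplex.obj z 0) h1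
  have o11 : W.obj 2 = DGSimplex.obj x 0 := congrArg (fun z => DGSimplex.obj z 1) h1
  have l2 : W.lab 1 (SimplexCategory.δ 2) = s.lab 1 (𝟙 ⦋1⦌) :=
    congrArg (fun z => DGSimplex.lab z 1 (𝟙 ⦋1⦌)) h2
  have l0 : W.lab 1 (SimplexCategory.δ 0) = s'.lab 1 (𝟙 ⦋1⦌) :=
    congrArg (fun z => DGSimplex.lab z 1 (𝟙 ⦋1⦌)) h0
  have l1 : W.lab 1 (SimplexCategory.δ 1) = idMat R (DGSimplex.obj x 0).rk :=
    (congrArg (fun z => DGSimplex.lab z 1 (𝟙 ⦋1⦌)) h1).trans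
      (DGSimplex.lab_id x (SimplexCategory.σ 0) rfl)
  have hx : W.obj 2 = s.obj 0 := o11.trans (o10.symm.trans o20)
  have heq := W.triangle_eq
  have hhom := W.triangle_isHom
  rw [hx, o20] at hhom
  rw [hx, o20, o21, l0, l1, l2, ← o10, o20] at heq
  exact ⟨hx.symm.trans o01, o21.symm.trans o00, _, hhom, heq⟩

theorem isQuasiIso_of_mem_core (s : DGSimplex R ⦋1⦌)
    (hs : s ∈ (core (dgNerve R)).obj (op ⦋1⦌)) :
    IsQuasiIso (s.obj 1) (s.obj 0) (s.lab 1 (𝟙 ⦋1⦌)) := by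
  obtain ⟨I⟩ := hs (𝟙 ⦋1⦌)
  have he : (dgNerve R).map (𝟙 ⦋1⦌).op s = s := by
    rw [op_id, CategoryTheory.Functor.map_id]
    rfl
  let s' : DGSimplex R ⦋1⦌ := I.inv.edge
  -- Labels reverse the direction of edges, so `homInvId` provides the homotopy on the target `s.obj
  -- 0` of the chain map, and `invHomId` the one on its source `s.obj 1`.
  obtain ⟨h01, h10, k, hk, hfg⟩ := exists_homotopy_of_compStruct I.homInvId s s' he rfl
  obtain ⟨-, -, h, hh, hgf⟩ := exists_homotopy_of_compStruct I.invHomId s' s rfl he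
  have hg := s'.edge_isHom
  have hgd := s'.edge_closed
  rw [← h10] at hg hgd hh hgf
  rw [← h01] at hg hgd hgf
  exact IsQuasiIso.of_homotopy s.edge_isHom hg s.edge_closed hgd hh hk hgf hfg

end Core

/-! ### The degree zero component is a quasi-isomorphism on stalks -/

section QuasiIso

variable {X : AlgebraicGeometry.RingedSpace.{u}} {ι : Type v} {U : ι → Opens X}
  (l : (Tot (cechTwist U)) _⦋1⦌)

theorem component_obj_eq_vertexComplex (a : ι) (v : Fin 2) :
    (component (Tot.eval l (SimplexCategory.σ (0 : Fin 1)) (step 0)) fun _ => a).obj v =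
      vertexComplex l v a := by
  have h := component_eval_comp l (SimplexCategory.const ⦋0⦌ ⦋1⦌ v)
    (SimplexCategory.σ (0 : Fin 1)) (step 0) fun _ => a
  have h1 : SimplexCategory.const ⦋0⦌ ⦋1⦌ v ≫ SimplexCategory.σ (0 : Fin 1) = 𝟙 ⦋0⦌ :=
    Subsingleton.elim _ _
  have h2 : SimplexCategory.const ⦋0⦌ ⦋1⦌ v ≫ step (0 : Fin 1) =
      SimplexCategory.const ⦋0⦌ ⦋1⦌ v := by
    ext i
    fin_cases v <;> rfl
  rw [h1, h2] at h
  exact congrArg (fun s => DGSimplex.obj s 0) h.symm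

/-- For `p = 0` the sum reduces to one edge of the core. The core is functorial in the ring, so the
image of this edge over the stalk is again invertible and is a homotopy equivalence there. -/
theorem pathCochain_quasiIso (a : ι) (x : X) (hx : x ∈ cechOpen U fun _ : Fin (0 + 1) => a) :
    IsQuasiIso ((vertexComplex l 1 a).map (X.presheaf.germ _ x hx).hom)
      ((vertexComplex l 0 a).map (X.presheaf.germ _ x hx).hom)
      ((pathCochain l 0 fun _ => a).map (X.presheaf.germ _ x hx).hom) := by
  have h := isQuasiIso_of_mem_core _
    ((coreFunctor.map (dgNerveFunctor.map (X.presheaf.germ _ x hx))).app (op ⦋1⦌)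
      (Tot.eval l (SimplexCategory.σ (0 : Fin 1)) (step 0) fun _ => a)).2
  rw [pathCochain_apply, Fin.sum_univ_one, ← component_obj_eq_vertexComplex,
    ← component_obj_eq_vertexComplex]
  have h0 : (((0 : Fin 1) : ℕ) : ℤ).negOnePow = 1 := rfl
  rw [h0, one_smul]
  exact h

end QuasiIso

end TwistCech

/-! ### The main theorem -/

theorem theorem4p2p2 (X : AlgebraicGeometry.RingedSpace.{u}) {ι : Type v}
    (U : ι → TopologicalSpace.Opens X) (hU : ⨆ a, U a = ⊤)
    (E F : (TwistCech.Tot (TwistCech.cechTwist U)) _⦋0⦌) (l : SSet.Edge E F) :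
    TwistCech.IsTwistingCochain (TwistCech.pointData E) ∧
    TwistCech.IsTwistingCochain (TwistCech.pointData F) ∧
    TwistCech.IsWeakEquivalence (TwistCech.pointData F) (TwistCech.pointData E)
      (TwistCech.pathCochain l.edge) := by
  refine ⟨TwistCech.isTwistingCochain_pointData E, TwistCech.isTwistingCochain_pointData F, ?_⟩
  -- The source of an edge is its face omitting vertex `1`, i.e. its restriction to vertex `0`; the
  -- target is the opposite one.
  have h0 : SimplexCategory.δ (1 : Fin 2) = SimplexCategory.const ⦋0⦌ ⦋1⦌ 0 := by
    ext i
    fin_cases i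
    rfl
  have h1 : SimplexCategory.δ (0 : Fin 2) = SimplexCategory.const ⦋0⦌ ⦋1⦌ 1 := by
    ext i
    fin_cases i
    rfl
  have hE := l.src_eq
  have hF := l.tgt_eq
  rw [SimplicialObject.δ, h0] at hE
  rw [SimplicialObject.δ, h1] at hF
  generalize l.edge = t at hE hF
  subst hE hF
  exact
    { isCochain := TwistCech.pathCochain_isCochain t
      closed := TwistCech.pathCochain_closed t
      quasiIso := fun a x hx => by
        rw [TwistCech.pointData_cx, TwistCech.pointData_cx]
        exact TwistCech.pathCochain_quasiIso t a x hx }
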